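/- \textbf{Theorem (Stability of Frozen ZO-Adam).} Let $x^\star\in\mathbb R^d$ be a local minimizer of $f:\mathbb R^d\to\mathbb R$, let $f$ be twice differentiable in a neighborhood of $x^\star$, and let $H=\nabla^2 f(x^\star)$, where $H\succeq 0$ and $H\neq 0$. Put $f_{\mathrm{quad}}(x)=f(x^\star)+\tfrac12(x-x^\star)^\top H(x-x^\star)$. Let $P\in\mathbb R^{d\times d}$ be symmetric positive definite, $\beta_1\in[0,1)$, $\mu>0$, and let $u_0,u_1,\dots$ be i.i.d. $\mathcal N(0,I_d)$ random vectors. For a step size $\eta>0$ and an initialization $x_0\in\mathbb R^d$, the linearized dynamics of Frozen ZO-Adam are, with $m_0=0$, \[ m_{t+1}=\beta_1m_t+(1-\beta_1)\,\frac{f_{\mathrm{quad}}(x_t+\mu u_t)-f_{\mathrm{quad}}(x_t-\mu u_t)}{2\mu}\,u_t,\qquad x_{t+1}=x_t-\eta P^{-1}m_{t+1}. \] Let \[ \eta^\star_{\mathrm{mean}}=\sup\Big\{\eta>0:\ \sup_{t\ge0}\big\|\mathbb E[x_t-x^\star]\big\|<\infty\ \text{for every } x_0\in\mathbb R^d\Big\},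 \] \[ \eta^\star_{\mathrm{ms}}=\sup\Big\{\eta>0:\ \sup_{t\ge0}\mathbb E\big[\|x_t-x^\star\|^2\big]<\infty\ \text{for every } x_0\in\mathbb R^d\Big\}. \] The eigenvalues of $P^{-1}H$, counted with algebraic multiplicity, are real and nonnegative; denote them by $\tilde\lambda_1\ge\dots\ge\tilde\lambda_d\ge0$ and write $\lambda_{\max}(P^{-1}H)=\tilde\lambda_1$. Then \[ \eta^\star_{\mathrm{mean}}=\frac{2(1+\beta_1)}{(1-\beta_1)\,\lambda_{\max}(P^{-1}H)}. \] If moreover $PH=HP$, then $\eta^\star_{\mathrm{ms}}$ is the unique $\eta>0$ satisfying \[ \eta\,\lambda_{\max}(P^{-1}H)<1+\beta_1\qquad\text{and}\qquad\sum_{i=1}^d\frac{\eta\tilde\lambda_i}{2\bigl(1-\frac{\eta\tilde\lambda_i}{1+\beta_1}\bigr)}=1, \] and it satisfies \[ \frac{2}{\operatorname{Tr}(P^{-1}H)+\frac{2\lambda_{\max}(P^{-1}H)}{1+\beta_1}}\ \le\ \eta^\star_{\mathrm{ms}}\ \le\ \frac{2}{\operatorname{Tr}(P^{-1}H)}. \]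 -/

import Mathlib

open MeasureTheory ProbabilityTheory Filter Topology Matrix

noncomputable section

namespace ZOAdam

/-- The parameter space `ℝ^d` with its Euclidean norm. -/
abbrev Vec (d : ℕ) : Type := EuclideanSpace ℝ (Fin d)

/-- `f` is twice differentiable in a neighbourhood of `x`. -/
def TwiceDifferentiableNear {d : ℕ} (f : Vec d → ℝ) (x : Vec d) : Prop :=
  ∀ᶠ y in 𝓝 x, DifferentiableAt ℝ f y ∧ DifferentiableAt ℝ (fderiv ℝ f) y

/-- The Hessian matrix `∇²f(x)`, with entries the second partial derivatives of `f` at `x`. -/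
def hessian {d : ℕ} (f : Vec d → ℝ) (x : Vec d) : Matrix (Fin d) (Fin d) ℝ :=
  Matrix.of fun i j =>
    fderiv ℝ (fderiv ℝ f) x (EuclideanSpace.single i 1) (EuclideanSpace.single j 1)

/-- The quadratic Taylor model
`f_quad(x) = f(x⋆) + (1/2) (x - x⋆)ᵀ H (x - x⋆)`, `H = ∇²f(x⋆)`, at a critical point `x⋆`. -/
def quadModel {d : ℕ} (f : Vec d → ℝ) (xstar : Vec d) (x : Vec d) : ℝ :=
  f xstar + 1 / 2 * inner ℝ (x - xstar) (Matrix.toEuclideanLin (hessian f xstar) (x - xstar))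

/-- The two-point zeroth-order gradient estimate of `g` at `x`, along the direction `u` and
with smoothing parameter `μ`. -/
def twoPointEstimator {d : ℕ} (g : Vec d → ℝ) (μ : ℝ) (u x : Vec d) : Vec d :=
  ((g (x + μ • u) - g (x - μ • u)) / (2 * μ)) • u

/-- The states `(x_t, m_t)` of Frozen ZO-Adam applied to the objective `g`, with momentum
parameter `β`, preconditioner `P`, step size `η`, directions `u 0, u 1, …`, started at `x0` with
`m_0 = 0`:
`m_{t+1} = β m_t + (1 - β) ∇̂g(x_t)` and `x_{t+1} = x_t - η P⁻¹ m_{t+1}`. -/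
def frozenZOAdamState {d : ℕ} (g : Vec d → ℝ) (μ β : ℝ) (P : Matrix (Fin d) (Fin d) ℝ)
    (η : ℝ) (u : ℕ → Vec d) (x0 : Vec d) : ℕ → Vec d × Vec d
  | 0 => (x0, 0)
  | t + 1 =>
    let s := frozenZOAdamState g μ β P η u x0 t
    let m' := β • s.2 + (1 - β) • twoPointEstimator g μ (u t) s.1
    (s.1 - η • Matrix.toEuclideanLin P⁻¹ m', m')

/-- The random iterates `x_t` of Frozen ZO-Adam applied to `g`, with random directions
`u 0, u 1, …`, as a function of the step size, the initialization, the time and the outcome. -/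
def frozenZOAdam {d : ℕ} {Ω : Type*} (g : Vec d → ℝ) (μ β : ℝ) (P : Matrix (Fin d) (Fin d) ℝ)
    (u : ℕ → Ω → Vec d) (η : ℝ) (x0 : Vec d) (t : ℕ) (ω : Ω) : Vec d :=
  (frozenZOAdamState g μ β P η (fun s => u s ω) x0 t).1

/-- Linear stability in the mean, for iterates `iter x0 t ω` indexed by the initialization,
the time and the outcome: `sup_t ‖E[x_t - x⋆]‖ < ∞` for every initialization (and the
expectations exist). -/
def StableInMean {d : ℕ} {Ω : Type*} [MeasurableSpace Ω] (ℙr : Measure Ω) (xstar : Vec d)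
    (iter : Vec d → ℕ → Ω → Vec d) : Prop :=
  ∀ x0 : Vec d, (∀ t, Integrable (fun ω => iter x0 t ω - xstar) ℙr) ∧
    BddAbove (Set.range fun t : ℕ => ‖∫ ω, (iter x0 t ω - xstar) ∂ℙr‖)

/-- Mean-square linear stability: `sup_t E[‖x_t - x⋆‖²] < ∞` for every initialization. -/
def StableInMeanSquare {d : ℕ} {Ω : Type*} [MeasurableSpace Ω] (ℙr : Measure Ω) (xstar : Vec d)
    (iter : Vec d → ℕ → Ω → Vec d) : Prop :=
  ∀ x0 : Vec d, (⨆ t : ℕ, ∫⁻ ω, ENNReal.ofReal (‖iter x0 t ω - xstar‖ ^ 2) ∂ℙr) < ⊤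

/-- `ηc` is the critical step size in the mean of the optimizer `opt` (whose first argument is
the step size): the supremum of the step sizes for which it is linearly stable in the mean. -/
def IsCriticalStepSizeMean {d : ℕ} {Ω : Type*} [MeasurableSpace Ω] (ℙr : Measure Ω)
    (xstar : Vec d) (opt : ℝ → Vec d → ℕ → Ω → Vec d) (ηc : ℝ) : Prop :=
  IsLUB {η : ℝ | 0 < η ∧ StableInMean ℙr xstar (opt η)} ηc

/-- `ηc` is the critical step size in the mean-square of the optimizer `opt`: the supremum of
the step sizes for which it is mean-square linearly stable. -/
def IsCriticalStepSizeMeanSquare {d : ℕ} {Ω : Type*} [MeasurableSpace Ω] (ℙr : Measure Ω)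
    (xstar : Vec d) (opt : ℝ → Vec d → ℕ → Ω → Vec d) (ηc : ℝ) : Prop :=
  IsLUB {η : ℝ | 0 < η ∧ StableInMeanSquare ℙr xstar (opt η)} ηc

/-- The real eigenvalues of a square real matrix, with algebraic multiplicity. -/
def eigs {d : ℕ} (A : Matrix (Fin d) (Fin d) ℝ) : Multiset ℝ := A.charpoly.roots

/-- The largest real eigenvalue of a square real matrix. -/
def lambdaMax {d : ℕ} (A : Matrix (Fin d) (Fin d) ℝ) : ℝ := sSup {l : ℝ | l ∈ eigs A}

end ZOAdam

end

/-! ### Gaussian moments and averaging over an independent direction. -/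

noncomputable section

namespace ZOAdam

/-! On the quadratic model the two-point estimate is exactly `⟨u, H w⟩ u` with `w = x - x⋆`, so the
dynamics are linear in `(w, m)` and driven by fresh Gaussian directions. For a generalized
eigenvector `H b = λ P b`, put `y = ⟨P b, w⟩` and `n = ⟨b, m⟩`. Then `y' = y - η n'` and `n' = β n +
(1 - β) ⟨b, u⟩ ⟨H w, u⟩`, where the product of inner products averages to `λ y`. By Wick's formula
the second moments `Y = E y²`, `C = E y n`, `M = E n²` satisfy a closed recursion up to a noise
intensity `S = ‖b‖² E‖H w‖²`. The squared means satisfy the same recursion with `S = -λ² Y`, so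
`IsMomentSeq` serves both notions of stability.

The core is `IsMomentSeq.lyap_succ`: a quadratic form `V` in `(y, n)` changes in one step by exactly
`(1 - β)² (S - (2λ/η)(1 - ηλ/(1+β)) Y)`. For the means and `λ > 0` this is a multiple of `Y` with
the sign of `ηλ(1 - β) - 2(1 + β)`, which gives the mean threshold.

If `P` and `H` commute, the `b i` can be taken orthonormal and `S = ∑ λ i² Y i`. Weighting each `V
i` by `gain` turns all the damping terms into `S` itself, so `∑ gain V` changes by `(1 - β)² (∑ gain
- 1) S` (`lyap_sum_succ`). When `∑ gain < 1`, this nonnegative quantity decreases and `S` is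
summable, which bounds every mode. When `∑ gain > 1`, it grows from a positive value, and
`not_bddAbove_of_lyapunov` excludes a bounded `S`. If `η λ_max ≥ 1 + β`, the top mode alone plays
that role. Strict monotonicity of `∑ gain` in `η` and the intermediate value theorem locate the
critical step size. -/

lemma integral_sq_gaussianReal (v : NNReal) : ∫ x, x ^ 2 ∂gaussianReal 0 v = v := by
  have h := variance_fun_id_gaussianReal (μ := 0) (v := v)
  rw [variance_eq_integral (by fun_prop)] at h
  simpa [integral_id_gaussianReal] using h

lemma integral_pow_four_gaussianReal (v : NNReal) :
    ∫ x, x ^ 4 ∂gaussianReal 0 v = 3 * (v : ℝ) ^ 2 := by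
  have h := iteratedDeriv_mgf_zero (X := id) (μ := gaussianReal 0 v)
    (by simp [integrableExpSet_id_gaussianReal]) 4
  have hint : ∫ x, (id ^ 4 : ℝ → ℝ) x ∂gaussianReal 0 v = ∫ x, x ^ 4 ∂gaussianReal 0 v := by
    simp
  rw [← hint, ← h, mgf_id_gaussianReal]
  have hE (t : ℝ) : HasDerivAt (fun t : ℝ => Real.exp (0 * t + v * t ^ 2 / 2))
      (Real.exp (0 * t + v * t ^ 2 / 2) * (v * t)) t := by
    refine HasDerivAt.exp ?_
    have := ((hasDerivAt_id' t).const_mul (0 : ℝ)).fun_add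
      ((((hasDerivAt_id' t).fun_pow 2).const_mul (v : ℝ)).div_const 2)
    exact this.congr_deriv (by norm_num; ring)
  -- Each derivative of the mgf is a polynomial times the same exponential. Cubic factors suffice,
  -- since the fourth derivative is only evaluated at zero.
  have hstep (a b c e : ℝ) : deriv (fun t : ℝ => (a + b * t + c * t ^ 2 + e * t ^ 3) *
      Real.exp (0 * t + v * t ^ 2 / 2)) = fun t => ((b + 2 * c * t + 3 * e * t ^ 2) +
      (a + b * t + c * t ^ 2 + e * t ^ 3) * (v * t)) * Real.exp (0 * t + v * t ^ 2 / 2) := by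
    ext t
    have hp : HasDerivAt (fun t : ℝ => a + b * t + c * t ^ 2 + e * t ^ 3)
        (b + 2 * c * t + 3 * e * t ^ 2) t := by
      have := ((((hasDerivAt_id' t).const_mul b).const_add a).fun_add
        (((hasDerivAt_id' t).fun_pow 2).const_mul c)).fun_add
        (((hasDerivAt_id' t).fun_pow 3).const_mul e)
      exact this.congr_deriv (by norm_num; ring)
    rw [(hp.fun_mul (hE t)).deriv]
    ring
  have h1 : deriv (fun t : ℝ => Real.exp (0 * t + v * t ^ 2 / 2)) =
      fun t => v * t * Real.exp (0 * t + v * t ^ 2 / 2) := by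
    simpa [mul_comm] using hstep 1 0 0 0
  have h2 : deriv (fun t : ℝ => v * t * Real.exp (0 * t + v * t ^ 2 / 2)) =
      fun t => (v + v ^ 2 * t ^ 2) * Real.exp (0 * t + v * t ^ 2 / 2) := by
    convert hstep 0 v 0 0 using 2 <;> ring_nf
  have h3 : deriv (fun t : ℝ => (v + v ^ 2 * t ^ 2) * Real.exp (0 * t + v * t ^ 2 / 2)) =
      fun t => (3 * v ^ 2 * t + v ^ 3 * t ^ 3) * Real.exp (0 * t + v * t ^ 2 / 2) := by
    convert hstep v 0 (v ^ 2) 0 using 2 <;> ring_nf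
  have h4 : deriv (fun t : ℝ => (3 * v ^ 2 * t + v ^ 3 * t ^ 3) *
      Real.exp (0 * t + v * t ^ 2 / 2)) 0 = 3 * (v : ℝ) ^ 2 := by
    have := congrFun (hstep 0 (3 * v ^ 2) 0 (v ^ 3)) 0
    simpa using this
  simp only [iteratedDeriv_succ, iteratedDeriv_zero]
  rw [h1, h2, h3, h4]

variable {d : ℕ}

lemma map_inner_stdGaussian (c : Vec d) :
    (stdGaussian (Vec d)).map (fun v => inner ℝ c v) =
      gaussianReal 0 (‖c‖ ^ 2).toNNReal := by
  have h := IsGaussian.map_eq_gaussianReal (μ := stdGaussian (Vec d)) (innerSL ℝ c)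
  rw [integral_strongDual_stdGaussian, variance_dual_stdGaussian, innerSL_apply_norm] at h
  exact h

lemma integral_inner_sq_stdGaussian (c : Vec d) :
    ∫ v, inner ℝ c v ^ 2 ∂stdGaussian (Vec d) = ‖c‖ ^ 2 := by
  have h := integral_map (μ := stdGaussian (Vec d)) (φ := fun v => inner ℝ c v)
    (by fun_prop) (f := fun x => x ^ 2) (by fun_prop)
  rw [← h, map_inner_stdGaussian, integral_sq_gaussianReal, Real.coe_toNNReal _ (by positivity)]

lemma integral_inner_pow_four_stdGaussian (c : Vec d) :
    ∫ v, inner ℝ c v ^ 4 ∂stdGaussian (Vec d) = 3 * (‖c‖ ^ 2) ^ 2 := by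
  have h := integral_map (μ := stdGaussian (Vec d)) (φ := fun v => inner ℝ c v)
    (by fun_prop) (f := fun x => x ^ 4) (by fun_prop)
  rw [← h, map_inner_stdGaussian, integral_pow_four_gaussianReal,
    Real.coe_toNNReal _ (by positivity)]

lemma integrable_norm_pow_stdGaussian (n : ℕ) :
    Integrable (fun v : Vec d => ‖v‖ ^ n) (stdGaussian (Vec d)) := by
  have h := (IsGaussian.memLp_id (stdGaussian (Vec d)) n (by simp)).integrable_norm_pow'
  simpa using h

/-- A continuous function of polynomial growth is integrable for the standard Gaussian. -/
lemma integrable_stdGaussian_of_le {φ : Vec d → ℝ} (hφ : Continuous φ) (C : ℝ) (n : ℕ)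
    (h : ∀ v, |φ v| ≤ C * ‖v‖ ^ n) : Integrable φ (stdGaussian (Vec d)) :=
  ((integrable_norm_pow_stdGaussian n).const_mul C).mono' hφ.aestronglyMeasurable
    (ae_of_all _ h)

lemma integrable_inner_mul_inner (a b : Vec d) :
    Integrable (fun v => inner ℝ a v * inner ℝ b v) (stdGaussian (Vec d)) := by
  refine integrable_stdGaussian_of_le (by fun_prop) (‖a‖ * ‖b‖) 2 fun v => ?_
  rw [abs_mul]
  calc _ ≤ (‖a‖ * ‖v‖) * (‖b‖ * ‖v‖) := mul_le_mul (abs_real_inner_le_norm _ _)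
        (abs_real_inner_le_norm _ _) (abs_nonneg _) (by positivity)
    _ = _ := by ring

lemma integrable_inner_sq_mul_inner_sq (a b : Vec d) :
    Integrable (fun v => inner ℝ a v ^ 2 * inner ℝ b v ^ 2) (stdGaussian (Vec d)) := by
  refine integrable_stdGaussian_of_le (by fun_prop) (‖a‖ ^ 2 * ‖b‖ ^ 2) 4 fun v => ?_
  rw [abs_mul, abs_pow, abs_pow]
  calc _ ≤ (‖a‖ * ‖v‖) ^ 2 * (‖b‖ * ‖v‖) ^ 2 := by
        gcongr <;> exact abs_real_inner_le_norm _ _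
    _ = _ := by ring

lemma integral_inner_mul_inner (a b : Vec d) :
    ∫ v, inner ℝ a v * inner ℝ b v ∂stdGaussian (Vec d) = inner ℝ a b := by
  have hi (c : Vec d) : Integrable (fun v => inner ℝ c v ^ 2) (stdGaussian (Vec d)) := by
    simpa [sq] using integrable_inner_mul_inner c c
  have h : (fun v => inner ℝ a v * inner ℝ b v) = fun v : Vec d =>
      (inner ℝ (a + b) v ^ 2 - inner ℝ (a - b) v ^ 2) / 4 := by
    ext v; simp only [inner_add_left, inner_sub_left]; ring
  rw [h, integral_div, integral_sub (hi _) (hi _), integral_inner_sq_stdGaussian,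
    integral_inner_sq_stdGaussian, norm_add_sq_real, norm_sub_sq_real]
  ring

/-- Wick's formula, from the fourth moments of one-dimensional marginals by the polarization `12 x²
y² = (x+y)⁴ + (x-y)⁴ - 2(x⁴ + y⁴)`. -/
lemma integral_inner_sq_mul_inner_sq (a b : Vec d) :
    ∫ v, inner ℝ a v ^ 2 * inner ℝ b v ^ 2 ∂stdGaussian (Vec d) =
      ‖a‖ ^ 2 * ‖b‖ ^ 2 + 2 * inner ℝ a b ^ 2 := by
  have hi (c : Vec d) : Integrable (fun v => inner ℝ c v ^ 4) (stdGaussian (Vec d)) := by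
    simpa [← pow_add] using integrable_inner_sq_mul_inner_sq c c
  have h : (fun v => inner ℝ a v ^ 2 * inner ℝ b v ^ 2) = fun v : Vec d =>
      ((inner ℝ (a + b) v ^ 4 + inner ℝ (a - b) v ^ 4) -
        2 * (inner ℝ a v ^ 4 + inner ℝ b v ^ 4)) / 12 := by
    ext v; simp only [inner_add_left, inner_sub_left]; ring
  have hadd (x y : Vec d) := (hi x).fun_add (hi y)
  rw [h, integral_div, integral_sub (hadd _ _) ((hadd _ _).const_mul 2), integral_const_mul,
    integral_add (hi _) (hi _), integral_add (hi _) (hi _)]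
  simp only [integral_inner_pow_four_stdGaussian, norm_add_sq_real, norm_sub_sq_real]
  ring

/-- Integration of a function of two independent random variables. -/
lemma integral_comp_indep {Ω E F : Type*} [MeasurableSpace Ω] [MeasurableSpace E]
    [MeasurableSpace F] {ℙr : Measure Ω} [IsProbabilityMeasure ℙr]
    {X : Ω → E} {U : Ω → F} {γ : Measure F} (hX : AEMeasurable X ℙr)
    (hU : HasLaw U γ ℙr) (hXU : IndepFun X U ℙr) {φ : E → F → ℝ}
    (hφ : Measurable (Function.uncurry φ)) {h : E → ℝ} {k : F → ℝ} (hh : Measurable h)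
    (hhX : Integrable (fun ω => h (X ω)) ℙr) (hk : Integrable k γ)
    (hle : ∀ x v, |φ x v| ≤ h x * k v) :
    Integrable (fun ω => φ (X ω) (U ω)) ℙr ∧
      ∫ ω, φ (X ω) (U ω) ∂ℙr = ∫ ω, (∫ v, φ (X ω) v ∂γ) ∂ℙr := by
  have : IsProbabilityMeasure γ := hU.map_eq ▸ Measure.isProbabilityMeasure_map hU.aemeasurable
  have : IsProbabilityMeasure (ℙr.map X) := Measure.isProbabilityMeasure_map hX
  have hmap := (indepFun_iff_map_prod_eq_prod_map_map hX hU.aemeasurable).1 hXU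
  rw [hU.map_eq] at hmap
  have hpair : AEMeasurable (fun ω => (X ω, U ω)) ℙr := hX.prodMk hU.aemeasurable
  have hhX' : Integrable h (ℙr.map X) :=
    (integrable_map_measure hh.aestronglyMeasurable hX).2 hhX
  have hint : Integrable (Function.uncurry φ) ((ℙr.map X).prod γ) :=
    (hhX'.mul_prod hk).mono' hφ.aestronglyMeasurable (ae_of_all _ fun z => hle z.1 z.2)
  constructor
  · rw [← hmap] at hint
    exact (integrable_map_measure hφ.aestronglyMeasurable hpair).1 hint
  · have h1 := integral_map hpair (f := Function.uncurry φ) hφ.aestronglyMeasurable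
    simp only [Function.uncurry_apply_pair] at h1
    rw [← h1, hmap, integral_prod _ hint]
    have h2 := hint.aestronglyMeasurable.integral_prod_right'
    rw [integral_map hX (f := fun x => ∫ v, Function.uncurry φ (x, v) ∂γ) h2]
    simp only [Function.uncurry_apply_pair]

end ZOAdam
end

/-! ### Lyapunov analysis of the moments of a single mode. -/

noncomputable section

namespace ZOAdam

/-- Coefficient of the cross term in the Lyapunov function of one mode. -/
def lyapCross (η β lam : ℝ) : ℝ := (1 - β) * (η * lam - (1 + β)) / (η * (1 + β))

/-- Coefficient of the remainder, after completing the square in `lyap`. -/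
def lyapRem (η β lam : ℝ) : ℝ :=
  (1 - β) * (η * lam) * (2 * (1 + β) - (1 - β) * (η * lam)) / (η ^ 2 * (1 + β) ^ 2)

/-- The Lyapunov function `E[(β n + k y)² + ρ y²]` of one mode, in terms of the second moments
`Y = E[y²]`, `C = E[y n]`, `M = E[n²]`. -/
def lyap (η β lam Y C M : ℝ) : ℝ :=
  (lyapRem η β lam + lyapCross η β lam ^ 2) * Y + 2 * β * lyapCross η β lam * C + β ^ 2 * M

/-- The second moments of position and momentum along one mode of curvature `lam`, when the
gradient noise has intensity `S`. -/
structure IsMomentSeq (η β lam : ℝ) (Y C M S : ℕ → ℝ) : Prop where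
  M_succ : ∀ t, M (t + 1) =
    β ^ 2 * M t + 2 * β * (1 - β) * (lam * C t) + (1 - β) ^ 2 * (S t + 2 * lam ^ 2 * Y t)
  C_succ : ∀ t, C (t + 1) = β * C t + (1 - β) * (lam * Y t) - η * M (t + 1)
  Y_succ : ∀ t, Y (t + 1) =
    Y t - 2 * η * (β * C t + (1 - β) * (lam * Y t)) + η ^ 2 * M (t + 1)
  C_zero : C 0 = 0
  M_zero : M 0 = 0
  Y_nonneg : ∀ t, 0 ≤ Y t
  M_nonneg : ∀ t, 0 ≤ M t
  C_le : ∀ t, |C t| ≤ (Y t + M t) / 2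
  M_le : ∀ t, M (t + 1) ≤ 2 * (Y t + Y (t + 1)) / η ^ 2
  lyap_nonneg : 0 ≤ lyapRem η β lam → ∀ t, 0 ≤ lyap η β lam (Y t) (C t) (M t)

variable {η β lam : ℝ} {Y C M S : ℕ → ℝ}

lemma lyapRem_nonneg (hη : 0 < η) (hβ1 : β < 1) (hlam : 0 ≤ lam)
    (h : η * lam * (1 - β) ≤ 2 * (1 + β)) : 0 ≤ lyapRem η β lam := by
  unfold lyapRem
  have : 0 ≤ 1 - β := by linarith
  have : 0 ≤ 2 * (1 + β) - (1 - β) * (η * lam) := by linarith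
  positivity

/-- No upper bound on `η * lam` is needed, unlike in `lyapRem_nonneg`: a positive starting value is
available in the unstable regime too, where the form may be indefinite. -/
lemma lyap_coeff_pos (hη : 0 < η) (hβ0 : 0 ≤ β) (hβ1 : β < 1) (hlam : 0 ≤ lam) :
    0 < lyapRem η β lam + lyapCross η β lam ^ 2 := by
  have h1 : 0 < 1 - β := by linarith
  have : lyapRem η β lam + lyapCross η β lam ^ 2 =
      (1 - β) * ((1 - β) * (1 + β) + 2 * β * (η * lam)) / (η ^ 2 * (1 + β)) := by
    unfold lyapRem lyapCross
    field_simp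
    ring
  rw [this]
  positivity

/-- With the coefficient of `M` normalized to `β ^ 2`, the other two coefficients of `lyap` are
those for which `C` and `M` cancel from the increment, leaving only the noise and a multiple of `Y`.
-/
lemma IsMomentSeq.lyap_succ (h : IsMomentSeq η β lam Y C M S) (hη : 0 < η) (hβ0 : 0 ≤ β)
    (t : ℕ) : lyap η β lam (Y (t + 1)) (C (t + 1)) (M (t + 1)) = lyap η β lam (Y t) (C t) (M t) +
      (1 - β) ^ 2 * (S t - 2 * lam / η * (1 - η * lam / (1 + β)) * Y t) := by
  rw [h.Y_succ, h.C_succ, h.M_succ]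
  unfold lyap lyapRem lyapCross
  have : 1 + β ≠ 0 := by positivity
  field_simp
  ring

/-- The momentum is the displacement divided by `-η`, so two consecutive positions control the whole
form, whatever the sign of its coefficients. -/
lemma exists_lyap_le (η β lam : ℝ) : ∃ K, 0 ≤ K ∧ ∀ Y0 Y1 C M : ℝ, 0 ≤ Y0 → 0 ≤ Y1 →
    |C| ≤ (Y1 + M) / 2 → 0 ≤ M → M ≤ 2 * (Y0 + Y1) / η ^ 2 →
    |lyap η β lam Y1 C M| ≤ K * (Y0 + Y1) := by
  refine ⟨|lyapRem η β lam + lyapCross η β lam ^ 2| + |2 * β * lyapCross η β lam| *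
    ((1 + 2 / η ^ 2) / 2) + β ^ 2 * (2 / η ^ 2), by positivity, ?_⟩
  intro Y0 Y1 C M h0 h1 hC hM hM2
  have hM3 : M ≤ 2 / η ^ 2 * (Y0 + Y1) := by rw [div_mul_eq_mul_div]; exact hM2
  have hC2 : |C| ≤ (1 + 2 / η ^ 2) / 2 * (Y0 + Y1) := by nlinarith
  unfold lyap
  refine (abs_add_three _ _ _).trans ?_
  rw [abs_mul _ Y1, abs_mul _ C, abs_mul (β ^ 2), abs_of_nonneg h1, abs_of_nonneg hM,
    abs_of_nonneg (sq_nonneg β), add_mul, add_mul,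
    mul_assoc |2 * β * lyapCross η β lam|, mul_assoc (β ^ 2)]
  gcongr
  linarith

/-- If `s` were bounded, so would be `L`, hence also the sums of `s`. Then `s` tends to zero and
drags the upper bound on `L` to zero, although `L` never falls below `L 0 > 0`. -/
lemma not_bddAbove_of_lyapunov {L s : ℕ → ℝ} {c K : ℝ} (hc : 0 < c) (hK : 0 ≤ K)
    (hs : ∀ t, 0 ≤ s t) (hL0 : 0 < L 0) (hstep : ∀ t, L t + c * s t ≤ L (t + 1))
    (hbd : ∀ t, L (t + 1) ≤ K * (s t + s (t + 1))) : ¬ BddAbove (Set.range s) := by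
  rintro ⟨B, hB⟩
  have hB' (t : ℕ) : s t ≤ B := hB ⟨t, rfl⟩
  have hsum (n : ℕ) : L 0 + c * ∑ k ∈ Finset.range n, s k ≤ L n := by
    induction n with
    | zero => simp
    | succ n ih => rw [Finset.sum_range_succ]; linarith [hstep n]
  have hsumm : Summable s := by
    refine summable_of_sum_range_le (c := K * (B + B) / c) hs fun n => ?_
    rw [le_div_iff₀ hc]
    have h1 := hsum (n + 1)
    rw [Finset.sum_range_succ] at h1
    have h2 : K * (s n + s (n + 1)) ≤ K * (B + B) :=
      mul_le_mul_of_nonneg_left (add_le_add (hB' _) (hB' _)) hK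
    nlinarith [hbd n, mul_nonneg hc.le (hs n)]
  have h0 := hsumm.tendsto_atTop_zero
  have h1 : Tendsto (fun t => K * (s t + s (t + 1))) atTop (𝓝 (K * (0 + 0))) :=
    (h0.add ((tendsto_add_atTop_iff_nat 1).2 h0)).const_mul K
  have h2 : L 0 ≤ K * (0 + 0) := by
    refine ge_of_tendsto' h1 fun t => le_trans ?_ (hbd t)
    have := hsum (t + 1)
    have : 0 ≤ c * ∑ k ∈ Finset.range (t + 1), s k :=
      mul_nonneg hc.le (Finset.sum_nonneg fun _ _ => hs _)
    linarith
  simp at h2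
  linarith

lemma IsMomentSeq.bddAbove_of_noiseless (h : IsMomentSeq η β lam Y C M fun t => -(lam ^ 2 * Y t))
    (hη : 0 < η) (hβ0 : 0 ≤ β) (hβ1 : β < 1) (hlam : 0 ≤ lam)
    (hlt : η * lam * (1 - β) < 2 * (1 + β)) : BddAbove (Set.range Y) := by
  rcases hlam.eq_or_lt with rfl | hpos
  -- A flat mode without noise never acquires momentum, so it stays put.
  · have hM (t : ℕ) : M t = 0 := by
      induction t with
      | zero => exact h.M_zero
      | succ t ih => rw [h.M_succ, ih]; simp
    have hC (t : ℕ) : C t = 0 := by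
      induction t with
      | zero => exact h.C_zero
      | succ t ih => rw [h.C_succ, ih, hM]; simp
    have hY (t : ℕ) : Y t = Y 0 := by
      induction t with
      | zero => rfl
      | succ t ih => rw [h.Y_succ, hC, hM, ih]; simp
    exact ⟨Y 0, by rintro _ ⟨t, rfl⟩; exact (hY t).le⟩
  · set c := (1 - β) ^ 2 * (lam / (η * (1 + β)) * (2 * (1 + β) - η * lam * (1 - β))) with hc
    have hβ : 0 < 1 - β := by linarith
    have hd : 0 < 2 * (1 + β) - η * lam * (1 - β) := by linarith
    have hcpos : 0 < c := by positivity
    have hV := h.lyap_nonneg (lyapRem_nonneg hη hβ1 hlam hlt.le)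
    have hstep (t : ℕ) : lyap η β lam (Y (t + 1)) (C (t + 1)) (M (t + 1)) =
        lyap η β lam (Y t) (C t) (M t) - c * Y t := by
      rw [h.lyap_succ hη hβ0, hc]
      field_simp
      ring
    have hle (t : ℕ) : lyap η β lam (Y t) (C t) (M t) ≤ lyap η β lam (Y 0) (C 0) (M 0) := by
      induction t with
      | zero => rfl
      | succ t ih => rw [hstep]; linarith [mul_nonneg hcpos.le (h.Y_nonneg t)]
    refine ⟨lyap η β lam (Y 0) (C 0) (M 0) / c, ?_⟩
    rintro _ ⟨t, rfl⟩
    rw [le_div_iff₀ hcpos]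
    linarith [hstep t, hle t, hV (t + 1)]

lemma IsMomentSeq.not_bddAbove_of_noiseless
    (h : IsMomentSeq η β lam Y C M fun t => -(lam ^ 2 * Y t))
    (hη : 0 < η) (hβ0 : 0 ≤ β) (hβ1 : β < 1) (hlam : 0 < lam)
    (hlt : 2 * (1 + β) < η * lam * (1 - β)) (hY0 : 0 < Y 0) : ¬ BddAbove (Set.range Y) := by
  obtain ⟨K, hK, hKle⟩ := exists_lyap_le η β lam
  have hβ : 0 < 1 - β := by linarith
  have hd : 0 < η * lam * (1 - β) - 2 * (1 + β) := by linarith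
  refine not_bddAbove_of_lyapunov (L := fun t => lyap η β lam (Y t) (C t) (M t))
    (c := (1 - β) ^ 2 * (lam / (η * (1 + β)) * (η * lam * (1 - β) - 2 * (1 + β))))
    (by positivity) hK h.Y_nonneg ?_ ?_ ?_
  · simp only [lyap, h.C_zero, h.M_zero, mul_zero, add_zero]
    exact mul_pos (lyap_coeff_pos hη hβ0 hβ1 hlam.le) hY0
  · intro t
    rw [h.lyap_succ hη hβ0]
    apply le_of_eq
    field_simp
    ring
  · intro t
    exact (le_abs_self _).trans (hKle _ _ _ _ (h.Y_nonneg _) (h.Y_nonneg _) (h.C_le _)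
      (h.M_nonneg _) (h.M_le _))

/-- The summand of the characteristic equation of the critical mean-square step size. -/
def gain (η β lam : ℝ) : ℝ := η * lam / (2 * (1 - η * lam / (1 + β)))

lemma one_sub_div_pos (hβ0 : 0 ≤ β) (h : η * lam < 1 + β) : 0 < 1 - η * lam / (1 + β) := by
  rw [sub_pos, div_lt_one (by linarith)]
  exact h

/-- This fixes the weight of a mode: after weighting, its damping is exactly its share `lam ^ 2 * Y`
of the noise. -/
lemma gain_mul (hη : 0 < η) (hβ0 : 0 ≤ β) (h : η * lam < 1 + β) :
    gain η β lam * (2 * lam / η * (1 - η * lam / (1 + β))) = lam ^ 2 := by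
  have := (one_sub_div_pos hβ0 h).ne'
  unfold gain
  generalize 1 - η * lam / (1 + β) = x at *
  field_simp

lemma gain_nonneg (hη : 0 < η) (hβ0 : 0 ≤ β) (hlam : 0 ≤ lam) (h : η * lam < 1 + β) :
    0 ≤ gain η β lam := by
  have := one_sub_div_pos hβ0 h
  unfold gain
  positivity

/-! ### Modes coupled through a common noise intensity. -/

section Family

variable {ι : Type*} [Fintype ι] {lam : ι → ℝ} {Y C M : ι → ℕ → ℝ}

lemma lyap_sum_succ (h : ∀ i, IsMomentSeq η β (lam i) (Y i) (C i) (M i) S)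
    (hS : ∀ t, S t = ∑ i, lam i ^ 2 * Y i t) (hη : 0 < η) (hβ0 : 0 ≤ β)
    (hlt : ∀ i, η * lam i < 1 + β) (t : ℕ) :
    ∑ i, gain η β (lam i) * lyap η β (lam i) (Y i (t + 1)) (C i (t + 1)) (M i (t + 1)) =
      ∑ i, gain η β (lam i) * lyap η β (lam i) (Y i t) (C i t) (M i t) +
        (1 - β) ^ 2 * (∑ i, gain η β (lam i) - 1) * S t := by
  have h1 : (1 - β) ^ 2 * (∑ i, gain η β (lam i) - 1) * S t =
      ∑ i, (1 - β) ^ 2 * (gain η β (lam i) * S t - lam i ^ 2 * Y i t) := by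
    rw [← Finset.mul_sum, Finset.sum_sub_distrib, ← Finset.sum_mul, ← hS]
    ring
  rw [h1, ← Finset.sum_add_distrib]
  refine Finset.sum_congr rfl fun i _ => ?_
  rw [(h i).lyap_succ hη hβ0, ← gain_mul hη hβ0 (hlt i)]
  ring

lemma bddAbove_of_sum_gain_lt_one (h : ∀ i, IsMomentSeq η β (lam i) (Y i) (C i) (M i) S)
    (hS : ∀ t, S t = ∑ i, lam i ^ 2 * Y i t) (hη : 0 < η) (hβ0 : 0 ≤ β) (hβ1 : β < 1)
    (hlam : ∀ i, 0 ≤ lam i) (hlt : ∀ i, η * lam i < 1 + β) (hF : ∑ i, gain η β (lam i) < 1)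
    (i : ι) : BddAbove (Set.range (Y i)) := by
  have hβ : 0 < 1 - β := by linarith
  set L : ℕ → ℝ := fun t => ∑ i, gain η β (lam i) * lyap η β (lam i) (Y i t) (C i t) (M i t)
    with hL
  have hLnn (t : ℕ) : 0 ≤ L t := by
    refine Finset.sum_nonneg fun j _ => mul_nonneg (gain_nonneg hη hβ0 (hlam j) (hlt j))
      ((h j).lyap_nonneg (lyapRem_nonneg hη hβ1 (hlam j) ?_) t)
    nlinarith [hlt j, mul_nonneg hη.le (hlam j)]
  set c := (1 - β) ^ 2 * (1 - ∑ i, gain η β (lam i)) with hc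
  have hcpos : 0 < c := mul_pos (by positivity) (by linarith)
  have hterm (j : ι) (t : ℕ) : 0 ≤ lam j ^ 2 * Y j t := mul_nonneg (sq_nonneg _) ((h j).Y_nonneg t)
  have hSnn (t : ℕ) : 0 ≤ S t := by
    rw [hS]; exact Finset.sum_nonneg fun j _ => hterm j t
  have hsum (n : ℕ) : c * ∑ k ∈ Finset.range n, S k = L 0 - L n := by
    induction n with
    | zero => simp
    | succ n ih =>
      have := lyap_sum_succ h hS hη hβ0 hlt n
      rw [Finset.sum_range_succ, mul_add, ih]
      simp only [hL] at this ⊢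
      rw [this, hc]
      ring
  have hsumle (n : ℕ) : ∑ k ∈ Finset.range n, S k ≤ L 0 / c := by
    rw [le_div_iff₀ hcpos]
    linarith [hsum n, hLnn n]
  -- A flat mode has zero weight and is invisible in `S`, so it needs its own argument: its Lyapunov
  -- function is driven by the summable noise alone, and it dominates `Y` because `C` and the cross
  -- coefficient are both nonpositive.
  rcases (hlam i).eq_or_lt with h0 | hpos
  · have hi := h i
    rw [← h0] at hi
    have hC (t : ℕ) : C i t ≤ 0 := by
      induction t with
      | zero => exact hi.C_zero.le
      | succ t ih =>
        rw [hi.C_succ]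
        nlinarith [mul_nonneg hη.le (hi.M_nonneg (t + 1)), mul_nonneg hβ0 (neg_nonneg.2 ih)]
    have hV (n : ℕ) : lyap η β 0 (Y i n) (C i n) (M i n) =
        lyap η β 0 (Y i 0) (C i 0) (M i 0) + (1 - β) ^ 2 * ∑ k ∈ Finset.range n, S k := by
      induction n with
      | zero => simp
      | succ n ih =>
        rw [hi.lyap_succ hη hβ0, ih, Finset.sum_range_succ]
        ring
    have ha := lyap_coeff_pos hη hβ0 hβ1 le_rfl
    refine ⟨(lyap η β 0 (Y i 0) (C i 0) (M i 0) + (1 - β) ^ 2 * (L 0 / c)) /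
      (lyapRem η β 0 + lyapCross η β 0 ^ 2), ?_⟩
    rintro _ ⟨t, rfl⟩
    rw [le_div_iff₀ ha]
    have hcr : lyapCross η β 0 ≤ 0 := by
      unfold lyapCross
      apply div_nonpos_of_nonpos_of_nonneg
      · nlinarith
      · positivity
    have h1 : lyap η β 0 (Y i t) (C i t) (M i t) ≤
        lyap η β 0 (Y i 0) (C i 0) (M i 0) + (1 - β) ^ 2 * (L 0 / c) := by
      rw [hV]
      gcongr
      exact hsumle t
    refine le_trans ?_ h1
    have h2 : 0 ≤ 2 * β * (lyapCross η β 0 * C i t) :=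
      mul_nonneg (by linarith) (mul_nonneg_of_nonpos_of_nonpos hcr (hC t))
    have h3 : 0 ≤ β ^ 2 * M i t := mul_nonneg (sq_nonneg _) (hi.M_nonneg t)
    unfold lyap
    linarith
  · refine ⟨L 0 / c / lam i ^ 2, ?_⟩
    rintro _ ⟨t, rfl⟩
    rw [le_div_iff₀ (by positivity)]
    have h1 : S t ≤ L 0 / c :=
      (Finset.single_le_sum (fun k _ => hSnn k) (Finset.self_mem_range_succ t)).trans
        (hsumle (t + 1))
    have h2 : lam i ^ 2 * Y i t ≤ S t := by
      rw [hS]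
      exact Finset.single_le_sum (fun j _ => hterm j t) (Finset.mem_univ i)
    linarith

/-- A mode of positive curvature is visible in the noise, `Y i ≤ S / lam i ^ 2`, so the bound by
positions becomes one by `S`. -/
lemma exists_lyap_le_noise (h : ∀ i, IsMomentSeq η β (lam i) (Y i) (C i) (M i) S)
    (hS : ∀ t, S t = ∑ i, lam i ^ 2 * Y i t) {i : ι} (hi : 0 < lam i) :
    ∃ K, 0 ≤ K ∧ ∀ t, |lyap η β (lam i) (Y i (t + 1)) (C i (t + 1)) (M i (t + 1))| ≤
      K * (S t + S (t + 1)) := by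
  obtain ⟨K, hK, hKle⟩ := exists_lyap_le η β (lam i)
  have h2 (t : ℕ) : Y i t ≤ S t / lam i ^ 2 := by
    rw [le_div_iff₀ (by positivity), mul_comm, hS]
    exact Finset.single_le_sum (f := fun j => lam j ^ 2 * Y j t)
      (fun j _ => mul_nonneg (sq_nonneg _) ((h j).Y_nonneg t)) (Finset.mem_univ i)
  refine ⟨K / lam i ^ 2, by positivity, fun t => ?_⟩
  refine (hKle _ _ _ _ ((h i).Y_nonneg t) ((h i).Y_nonneg _) ((h i).C_le _)
      ((h i).M_nonneg _) ((h i).M_le _)).trans ?_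
  calc K * (Y i t + Y i (t + 1)) ≤ K * (S t / lam i ^ 2 + S (t + 1) / lam i ^ 2) := by
        gcongr <;> exact h2 _
    _ = _ := by ring

lemma noise_nonneg (h : ∀ i, IsMomentSeq η β (lam i) (Y i) (C i) (M i) S)
    (hS : ∀ t, S t = ∑ i, lam i ^ 2 * Y i t) (t : ℕ) : 0 ≤ S t := by
  rw [hS]
  exact Finset.sum_nonneg fun j _ => mul_nonneg (sq_nonneg _) ((h j).Y_nonneg t)

lemma not_bddAbove_of_one_lt_sum_gain (h : ∀ i, IsMomentSeq η β (lam i) (Y i) (C i) (M i) S)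
    (hS : ∀ t, S t = ∑ i, lam i ^ 2 * Y i t) (hη : 0 < η) (hβ0 : 0 ≤ β) (hβ1 : β < 1)
    (hlam : ∀ i, 0 ≤ lam i) (hlt : ∀ i, η * lam i < 1 + β) (hF : 1 < ∑ i, gain η β (lam i))
    {i : ι} (hi : 0 < lam i) (hY0 : 0 < Y i 0) : ¬ BddAbove (Set.range S) := by
  have hβ : 0 < 1 - β := by linarith
  have hK (j : ι) : ∃ K, 0 ≤ K ∧ ∀ t, gain η β (lam j) *
      lyap η β (lam j) (Y j (t + 1)) (C j (t + 1)) (M j (t + 1)) ≤ K * (S t + S (t + 1)) := by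
    rcases (hlam j).eq_or_lt with h0 | hpos
    · exact ⟨0, le_rfl, fun t => by simp [gain, ← h0]⟩
    · obtain ⟨K, hK, hKle⟩ := exists_lyap_le_noise h hS hpos
      have hg := gain_nonneg hη hβ0 (hlam j) (hlt j)
      refine ⟨gain η β (lam j) * K, mul_nonneg hg hK, fun t => ?_⟩
      rw [mul_assoc]
      exact mul_le_mul_of_nonneg_left ((le_abs_self _).trans (hKle t)) hg
  choose K hK hKle using hK
  have hnn (j : ι) : 0 ≤ gain η β (lam j) * lyap η β (lam j) (Y j 0) (C j 0) (M j 0) := by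
    simp only [lyap, (h j).C_zero, (h j).M_zero, mul_zero, add_zero]
    exact mul_nonneg (gain_nonneg hη hβ0 (hlam j) (hlt j))
      (mul_nonneg (lyap_coeff_pos hη hβ0 hβ1 (hlam j)).le ((h j).Y_nonneg 0))
  refine not_bddAbove_of_lyapunov
    (L := fun t => ∑ i, gain η β (lam i) * lyap η β (lam i) (Y i t) (C i t) (M i t))
    (c := (1 - β) ^ 2 * (∑ i, gain η β (lam i) - 1)) (K := ∑ j, K j)
    (mul_pos (by positivity) (by linarith)) (Finset.sum_nonneg fun j _ => hK j)
    (noise_nonneg h hS) ?_ (fun t => (lyap_sum_succ h hS hη hβ0 hlt t).ge) ?_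
  · refine Finset.sum_pos' (fun j _ => hnn j) ⟨i, Finset.mem_univ i, ?_⟩
    simp only [lyap, (h i).C_zero, (h i).M_zero, mul_zero, add_zero]
    refine mul_pos ?_ (mul_pos (lyap_coeff_pos hη hβ0 hβ1 (hlam i)) hY0)
    have := one_sub_div_pos hβ0 (hlt i)
    unfold gain
    positivity
  · intro t
    rw [Finset.sum_mul]
    exact Finset.sum_le_sum fun j _ => hKle j t

/-- From `η * lam i = 1 + β` on, the damping of this mode vanishes or changes sign, so its own
Lyapunov function absorbs all the noise and no weighted sum is needed. -/
lemma not_bddAbove_of_le_mul (h : ∀ i, IsMomentSeq η β (lam i) (Y i) (C i) (M i) S)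
    (hS : ∀ t, S t = ∑ i, lam i ^ 2 * Y i t) (hη : 0 < η) (hβ0 : 0 ≤ β) (hβ1 : β < 1)
    {i : ι} (hi : 0 < lam i) (hle : 1 + β ≤ η * lam i) (hY0 : 0 < Y i 0) :
    ¬ BddAbove (Set.range S) := by
  have hβ : 0 < 1 - β := by linarith
  obtain ⟨K, hK, hKle⟩ := exists_lyap_le_noise h hS hi
  refine not_bddAbove_of_lyapunov (L := fun t => lyap η β (lam i) (Y i t) (C i t) (M i t))
    (c := (1 - β) ^ 2) (by positivity) hK (noise_nonneg h hS) ?_ (fun t => ?_)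
    fun t => (le_abs_self _).trans (hKle t)
  · simp only [lyap, (h i).C_zero, (h i).M_zero, mul_zero, add_zero]
    exact mul_pos (lyap_coeff_pos hη hβ0 hβ1 hi.le) hY0
  · rw [(h i).lyap_succ hη hβ0]
    have h1 : 1 - η * lam i / (1 + β) ≤ 0 := by
      rw [sub_nonpos, le_div_iff₀ (by linarith), one_mul]
      exact hle
    have h2 : 2 * lam i / η * (1 - η * lam i / (1 + β)) * Y i t ≤ 0 :=
      mul_nonpos_of_nonpos_of_nonneg
        (mul_nonpos_of_nonneg_of_nonpos (by positivity) h1) ((h i).Y_nonneg t)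
    gcongr
    linarith

end Family

end ZOAdam
end

/-! ### The random linear dynamics and their moment recursions. -/

noncomputable section

namespace ZOAdam

variable {d : ℕ}

/-- One step of the centered linear dynamics, with state `(w, m)` and direction `v`. -/
def zoStep (A B : Vec d →L[ℝ] Vec d) (β η : ℝ) (s : Vec d × Vec d) (v : Vec d) : Vec d × Vec d :=
  (s.1 - η • B (β • s.2 + (1 - β) • (inner ℝ v (A s.1) • v)),
    β • s.2 + (1 - β) • (inner ℝ v (A s.1) • v))

/-- The states `(w_t, m_t)` of the centered linear dynamics. -/
def zoState (A B : Vec d →L[ℝ] Vec d) (β η : ℝ) (w0 : Vec d) (u : ℕ → Vec d) :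
    ℕ → Vec d × Vec d
  | 0 => (w0, 0)
  | t + 1 => zoStep A B β η (zoState A B β η w0 u t) (u t)

variable {A B : Vec d →L[ℝ] Vec d} {β η : ℝ} {w0 : Vec d}

lemma continuous_zoStep : Continuous (Function.uncurry (zoStep A B β η)) := by
  unfold zoStep Function.uncurry
  fun_prop

lemma continuous_zoState (t : ℕ) : Continuous fun u => zoState A B β η w0 u t := by
  induction t with
  | zero => exact continuous_const
  | succ t ih => exact continuous_zoStep.comp (ih.prodMk (continuous_apply t))

lemma zoState_congr {u v : ℕ → Vec d} (t : ℕ) (h : ∀ s < t, u s = v s) :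
    zoState A B β η w0 u t = zoState A B β η w0 v t := by
  induction t with
  | zero => rfl
  | succ t ih =>
    simp only [zoState]
    rw [ih fun s hs => h s (by omega), h t (by omega)]

section Trajectory

variable {Ω : Type*} [MeasurableSpace Ω] {ℙr : Measure Ω} {u : ℕ → Ω → Vec d}

lemma aemeasurable_zoState (hu : ∀ t, AEMeasurable (u t) ℙr) (t : ℕ) :
    AEMeasurable (fun ω => zoState A B β η w0 (fun s => u s ω) t) ℙr :=
  (continuous_zoState t).measurable.comp_aemeasurable (aemeasurable_pi_lambda _ hu)

lemma indepFun_zoState (hindep : iIndepFun u ℙr) (hu : ∀ t, AEMeasurable (u t) ℙr) (t : ℕ) :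
    IndepFun (fun ω => zoState A B β η w0 (fun s => u s ω) t) (u t) ℙr := by
  have h := hindep.indepFun_finset₀ (Finset.range t) {t} (by simp) hu
  -- The state at time `t` is written as a function of the first `t` directions only. The value `0`
  -- for later directions is irrelevant by `zoState_congr`.
  have hcont : Continuous fun v : Finset.range t → Vec d =>
      zoState A B β η w0 (fun s => if hs : s ∈ Finset.range t then v ⟨s, hs⟩ else 0) t := by
    refine (continuous_zoState t).comp (continuous_pi fun s => ?_)
    by_cases hs : s ∈ Finset.range t
    · simp only [hs, dite_true]; fun_prop
    · simp only [hs, dite_false]; fun_prop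
  have h2 := h.comp hcont.measurable
    (measurable_pi_apply (⟨t, Finset.mem_singleton_self t⟩ : ({t} : Finset ℕ)))
  have he : (fun ω => zoState A B β η w0 (fun s => u s ω) t) =
      (fun v : Finset.range t → Vec d =>
        zoState A B β η w0 (fun s => if hs : s ∈ Finset.range t then v ⟨s, hs⟩ else 0) t) ∘
      fun ω (i : Finset.range t) => u i ω := by
    ext1 ω
    refine zoState_congr t fun s hs => ?_
    simp [hs]
  rw [he]
  exact h2

variable (A) in
/-- Bound for the squared norm of the updated momentum. -/
def momBound (s : Vec d × Vec d) : ℝ := 2 * ‖s.2‖ ^ 2 + 2 * ‖A‖ ^ 2 * ‖s.1‖ ^ 2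

lemma measurable_momBound : Measurable (momBound A) := by
  unfold momBound; fun_prop

lemma integrable_one_add_norm_pow :
    Integrable (fun v : Vec d => 1 + ‖v‖ ^ 4) (stdGaussian (Vec d)) :=
  (integrable_const _).add (integrable_norm_pow_stdGaussian 4)

lemma norm_zoStep_snd_sq_le (hβ0 : 0 ≤ β) (hβ1 : β < 1) (s : Vec d × Vec d) (v : Vec d) :
    ‖(zoStep A B β η s v).2‖ ^ 2 ≤ momBound A s * (1 + ‖v‖ ^ 4) := by
  have h1 : ‖(zoStep A B β η s v).2‖ ≤ ‖s.2‖ + ‖A‖ * ‖s.1‖ * ‖v‖ ^ 2 := by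
    unfold zoStep
    refine (norm_add_le _ _).trans ?_
    rw [norm_smul, norm_smul, norm_smul, Real.norm_of_nonneg hβ0,
      Real.norm_of_nonneg (by linarith : 0 ≤ 1 - β)]
    have h2 : ‖(inner ℝ v (A s.1) : ℝ)‖ * ‖v‖ ≤ ‖A‖ * ‖s.1‖ * ‖v‖ ^ 2 := by
      calc _ ≤ (‖v‖ * (‖A‖ * ‖s.1‖)) * ‖v‖ := by
            gcongr
            exact (norm_inner_le_norm _ _).trans (by gcongr; exact A.le_opNorm _)
        _ = _ := by ring
    have h3 : 0 ≤ ‖(inner ℝ v (A s.1) : ℝ)‖ * ‖v‖ := by positivity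
    nlinarith [norm_nonneg s.2]
  calc _ ≤ (‖s.2‖ + ‖A‖ * ‖s.1‖ * ‖v‖ ^ 2) ^ 2 := by gcongr
    _ ≤ 2 * (‖s.2‖ ^ 2 + (‖A‖ * ‖s.1‖ * ‖v‖ ^ 2) ^ 2) := add_sq_le
    _ ≤ _ := by
      unfold momBound
      have : 0 ≤ 2 * ‖s.2‖ ^ 2 * ‖v‖ ^ 4 + 2 * ‖A‖ ^ 2 * ‖s.1‖ ^ 2 := by positivity
      linarith

/-- Square integrability propagates because the squared new momentum is dominated by a product of an
integrable function of the state and a Gaussian-integrable function of the independent direction. -/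
lemma memLp_zoState [IsProbabilityMeasure ℙr] (hβ0 : 0 ≤ β) (hβ1 : β < 1) (hindep : iIndepFun u ℙr)
    (hlaw : ∀ t, HasLaw (u t) (stdGaussian (Vec d)) ℙr) (t : ℕ) :
    MemLp (fun ω => (zoState A B β η w0 (fun s => u s ω) t).1) 2 ℙr ∧
      MemLp (fun ω => (zoState A B β η w0 (fun s => u s ω) t).2) 2 ℙr := by
  have hu (t) := (hlaw t).aemeasurable
  have hm (t) := aemeasurable_zoState (A := A) (B := B) (β := β) (η := η) (w0 := w0) hu t
  induction t with
  | zero => exact ⟨memLp_const _, memLp_const _⟩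
  | succ t ih =>
    have hh : Integrable (fun ω => momBound A (zoState A B β η w0 (fun s => u s ω) t)) ℙr := by
      unfold momBound
      exact (ih.2.integrable_norm_pow'.const_mul 2).add (ih.1.integrable_norm_pow'.const_mul _)
    have h2 := (integral_comp_indep (hm t) (hlaw t) (indepFun_zoState hindep hu t)
      (φ := fun s v => ‖(zoStep A B β η s v).2‖ ^ 2)
      ((continuous_zoStep.snd.norm.pow 2).measurable) measurable_momBound hh
      integrable_one_add_norm_pow (fun s v => by
        rw [abs_of_nonneg (by positivity)]
        exact norm_zoStep_snd_sq_le hβ0 hβ1 s v)).1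
    have h3 : MemLp (fun ω => (zoState A B β η w0 (fun s => u s ω) (t + 1)).2) 2 ℙr := by
      rw [memLp_two_iff_integrable_sq_norm (hm (t + 1)).snd.aestronglyMeasurable]
      exact h2
    exact ⟨ih.1.sub ((B.comp_memLp' h3).const_smul η), h3⟩

variable [IsProbabilityMeasure ℙr] {a b : Vec d} {lam : ℝ}

lemma inner_zoStep_snd (s : Vec d × Vec d) (v : Vec d) :
    inner ℝ b (zoStep A B β η s v).2 =
      β * inner ℝ b s.2 + (1 - β) * (inner ℝ b v * inner ℝ (A s.1) v) := by
  simp only [zoStep, inner_add_right, inner_smul_right, real_inner_comm v (A s.1)]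
  ring

lemma inner_zoStep_fst (hB : ∀ m, inner ℝ a (B m) = inner ℝ b m) (s : Vec d × Vec d)
    (v : Vec d) : inner ℝ a (zoStep A B β η s v).1 =
      inner ℝ a s.1 - η * inner ℝ b (zoStep A B β η s v).2 := by
  simp only [zoStep, inner_sub_right, inner_smul_right, hB]

lemma inner_apply_eq (hA : ∀ x y, inner ℝ (A x) y = inner ℝ x (A y)) (hAb : A b = lam • a)
    (w : Vec d) : inner ℝ b (A w) = lam * inner ℝ a w := by
  rw [← hA, hAb, real_inner_smul_left]

lemma integral_inner_zoStep_snd (hA : ∀ x y, inner ℝ (A x) y = inner ℝ x (A y))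
    (hAb : A b = lam • a) (s : Vec d × Vec d) :
    ∫ v, inner ℝ b (zoStep A B β η s v).2 ∂stdGaussian (Vec d) =
      β * inner ℝ b s.2 + (1 - β) * (lam * inner ℝ a s.1) := by
  simp only [inner_zoStep_snd]
  rw [integral_add (integrable_const _) ((integrable_inner_mul_inner _ _).const_mul _),
    integral_const_mul (1 - β), integral_inner_mul_inner, inner_apply_eq hA hAb]
  simp

lemma integral_inner_zoStep_snd_sq (hA : ∀ x y, inner ℝ (A x) y = inner ℝ x (A y))
    (hAb : A b = lam • a) (s : Vec d × Vec d) :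
    ∫ v, inner ℝ b (zoStep A B β η s v).2 ^ 2 ∂stdGaussian (Vec d) =
      β ^ 2 * inner ℝ b s.2 ^ 2 + 2 * β * (1 - β) * (lam * (inner ℝ a s.1 * inner ℝ b s.2)) +
        (1 - β) ^ 2 * (‖b‖ ^ 2 * ‖A s.1‖ ^ 2 + 2 * lam ^ 2 * inner ℝ a s.1 ^ 2) := by
  have h : (fun v => inner ℝ b (zoStep A B β η s v).2 ^ 2) = fun v =>
      (β ^ 2 * inner ℝ b s.2 ^ 2 + 2 * β * (1 - β) * inner ℝ b s.2 *
        (inner ℝ b v * inner ℝ (A s.1) v)) +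
        (1 - β) ^ 2 * (inner ℝ b v ^ 2 * inner ℝ (A s.1) v ^ 2) := by
    ext v
    rw [inner_zoStep_snd]
    ring
  rw [h, integral_add ((integrable_const _).fun_add ((integrable_inner_mul_inner _ _).const_mul _))
    ((integrable_inner_sq_mul_inner_sq _ _).const_mul _),
    integral_add (integrable_const _) ((integrable_inner_mul_inner _ _).const_mul _),
    integral_const_mul (2 * β * (1 - β) * inner ℝ b s.2), integral_const_mul ((1 - β) ^ 2),
    integral_inner_mul_inner, integral_inner_sq_mul_inner_sq, inner_apply_eq hA hAb, integral_const]
  simp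
  ring

/-- One-step recursions for the first and second moments of a mode. -/
lemma moments_succ (hβ0 : 0 ≤ β) (hβ1 : β < 1) (hindep : iIndepFun u ℙr)
    (hlaw : ∀ t, HasLaw (u t) (stdGaussian (Vec d)) ℙr)
    (hA : ∀ x y, inner ℝ (A x) y = inner ℝ x (A y)) (hAb : A b = lam • a) (t : ℕ)
    {X : ℕ → Ω → Vec d × Vec d} (hX : X = fun t ω => zoState A B β η w0 (fun s => u s ω) t) :
    (∫ ω, inner ℝ b (X (t + 1) ω).2 ∂ℙr = β * ∫ ω, inner ℝ b (X t ω).2 ∂ℙr +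
      (1 - β) * (lam * ∫ ω, inner ℝ a (X t ω).1 ∂ℙr)) ∧
    (∫ ω, inner ℝ a (X t ω).1 * inner ℝ b (X (t + 1) ω).2 ∂ℙr =
      β * ∫ ω, inner ℝ a (X t ω).1 * inner ℝ b (X t ω).2 ∂ℙr +
      (1 - β) * (lam * ∫ ω, inner ℝ a (X t ω).1 ^ 2 ∂ℙr)) ∧
    (∫ ω, inner ℝ b (X (t + 1) ω).2 ^ 2 ∂ℙr = β ^ 2 * ∫ ω, inner ℝ b (X t ω).2 ^ 2 ∂ℙr +
      2 * β * (1 - β) * (lam * ∫ ω, inner ℝ a (X t ω).1 * inner ℝ b (X t ω).2 ∂ℙr) +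
      (1 - β) ^ 2 * (∫ ω, ‖b‖ ^ 2 * ‖A (X t ω).1‖ ^ 2 ∂ℙr +
        2 * lam ^ 2 * ∫ ω, inner ℝ a (X t ω).1 ^ 2 ∂ℙr)) := by
  have hu (t) := (hlaw t).aemeasurable
  have hm : AEMeasurable (X t) ℙr := by rw [hX]; exact aemeasurable_zoState hu t
  have hind : IndepFun (X t) (u t) ℙr := by rw [hX]; exact indepFun_zoState hindep hu t
  have hXs (ω : Ω) : X (t + 1) ω = zoStep A B β η (X t ω) (u t ω) := by rw [hX]; rfl
  obtain ⟨h1, h2⟩ : MemLp (fun ω => (X t ω).1) 2 ℙr ∧ MemLp (fun ω => (X t ω).2) 2 ℙr := by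
    rw [hX]; exact memLp_zoState hβ0 hβ1 hindep hlaw t
  have hh : Integrable (fun ω => momBound A (X t ω)) ℙr := by
    unfold momBound
    exact (h2.integrable_norm_pow'.const_mul 2).add (h1.integrable_norm_pow'.const_mul _)
  have ha : MemLp (fun ω => inner ℝ a (X t ω).1) 2 ℙr := (innerSL ℝ a).comp_memLp' h1
  have hb : MemLp (fun ω => inner ℝ b (X t ω).2) 2 ℙr := (innerSL ℝ b).comp_memLp' h2
  have hAw : MemLp (fun ω => A (X t ω).1) 2 ℙr := A.comp_memLp' h1
  have hia := ha.integrable one_le_two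
  have hib := hb.integrable one_le_two
  have hiaa := ha.integrable_sq
  have hibb := hb.integrable_sq
  have hiab : Integrable (fun ω => inner ℝ a (X t ω).1 * inner ℝ b (X t ω).2) ℙr :=
    ha.integrable_mul hb
  have hiA : Integrable (fun ω => ‖b‖ ^ 2 * ‖A (X t ω).1‖ ^ 2) ℙr :=
    hAw.integrable_norm_pow'.const_mul _
  have hcont2 : Continuous (Function.uncurry fun s v => inner ℝ b (zoStep A B β η s v).2) :=
    continuous_const.inner continuous_zoStep.snd
  have hcont1 : Continuous (Function.uncurry fun (s : Vec d × Vec d) (_ : Vec d) =>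
      inner ℝ a s.1) := continuous_const.inner continuous_fst.fst
  have hsq (s : Vec d × Vec d) (v : Vec d) : inner ℝ b (zoStep A B β η s v).2 ^ 2 ≤
      ‖b‖ ^ 2 * momBound A s * (1 + ‖v‖ ^ 4) := by
    rw [mul_assoc]
    calc _ ≤ (‖b‖ * ‖(zoStep A B β η s v).2‖) ^ 2 :=
          sq_le_sq.2 ((abs_real_inner_le_norm _ _).trans (le_abs_self _))
      _ = ‖b‖ ^ 2 * ‖(zoStep A B β η s v).2‖ ^ 2 := by ring
      _ ≤ _ := by gcongr; exact norm_zoStep_snd_sq_le hβ0 hβ1 s v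
  have hk (v : Vec d) : 1 ≤ 1 + ‖v‖ ^ 4 := le_add_of_nonneg_right (by positivity)
  -- A Young-type domination, used with `c = 1` for the first moment and with `c` the position
  -- coordinate for the mixed moment.
  have hprod (c : ℝ) (s : Vec d × Vec d) (v : Vec d) :
      |c * inner ℝ b (zoStep A B β η s v).2| ≤
        (c ^ 2 + ‖b‖ ^ 2 * momBound A s) * (1 + ‖v‖ ^ 4) := by
    have h0 := hsq s v
    have h1 : c ^ 2 ≤ c ^ 2 * (1 + ‖v‖ ^ 4) := le_mul_of_one_le_right (sq_nonneg _) (hk v)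
    rw [add_mul, abs_le]
    constructor <;> nlinarith [sq_nonneg (c + inner ℝ b (zoStep A B β η s v).2),
      sq_nonneg (c - inner ℝ b (zoStep A B β η s v).2), sq_nonneg c,
      sq_nonneg (inner ℝ b (zoStep A B β η s v).2)]
  simp only [hXs]
  refine ⟨?_, ?_, ?_⟩
  · rw [(integral_comp_indep hm (hlaw t) hind
      (φ := fun s v => inner ℝ b (zoStep A B β η s v).2) hcont2.measurable
      (h := fun s => 1 ^ 2 + ‖b‖ ^ 2 * momBound A s)
      ((measurable_momBound.const_mul _).const_add _)
      ((integrable_const _).add (hh.const_mul _))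
      integrable_one_add_norm_pow fun s v => by simpa using hprod 1 s v).2]
    simp only [integral_inner_zoStep_snd hA hAb]
    rw [integral_add (hib.const_mul _) ((hia.const_mul _).const_mul _)]
    simp only [integral_const_mul]
  · rw [(integral_comp_indep hm (hlaw t) hind
      (φ := fun s v => inner ℝ a s.1 * inner ℝ b (zoStep A B β η s v).2)
      (hcont1.mul hcont2).measurable
      (h := fun s => inner ℝ a s.1 ^ 2 + ‖b‖ ^ 2 * momBound A s)
      ((by fun_prop : Measurable fun s : Vec d × Vec d => (inner ℝ a s.1 : ℝ) ^ 2).add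
        (measurable_momBound.const_mul _))
      (hiaa.add (hh.const_mul _)) integrable_one_add_norm_pow fun s v => hprod _ s v).2]
    simp only [integral_const_mul, integral_inner_zoStep_snd hA hAb]
    rw [← integral_const_mul, ← integral_const_mul, ← integral_const_mul,
      ← integral_add (hiab.const_mul _) ((hiaa.const_mul _).const_mul _)]
    congr 1
    ext ω
    ring
  · rw [(integral_comp_indep hm (hlaw t) hind
      (φ := fun s v => inner ℝ b (zoStep A B β η s v).2 ^ 2) (hcont2.measurable.pow_const 2)
      (h := fun s => ‖b‖ ^ 2 * momBound A s) (measurable_momBound.const_mul _)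
      (hh.const_mul _) integrable_one_add_norm_pow fun s v => by
        rw [abs_of_nonneg (sq_nonneg _)]; exact hsq s v).2]
    simp only [integral_inner_zoStep_snd_sq hA hAb]
    rw [integral_add ((hibb.const_mul _).fun_add ((hiab.const_mul _).const_mul _))
      ((hiA.fun_add (hiaa.const_mul _)).const_mul _),
      integral_add (hibb.const_mul _) ((hiab.const_mul _).const_mul _)]
    simp only [integral_const_mul]
    rw [integral_add hiA (hiaa.const_mul _)]
    simp only [integral_const_mul]

lemma lyap_sq_nonneg (hrem : 0 ≤ lyapRem η β lam) (y n : ℝ) :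
    0 ≤ lyap η β lam (y ^ 2) (y * n) (n ^ 2) := by
  have : lyap η β lam (y ^ 2) (y * n) (n ^ 2) =
      (β * n + lyapCross η β lam * y) ^ 2 + lyapRem η β lam * y ^ 2 := by
    unfold lyap; ring
  rw [this]
  positivity

lemma abs_mul_le_half_add_sq (y n : ℝ) : |y * n| ≤ (y ^ 2 + n ^ 2) / 2 := by
  rw [abs_le]
  constructor <;> nlinarith [sq_nonneg (y + n), sq_nonneg (y - n)]

lemma momentum_sq_le (hη : 0 < η) {y y' n : ℝ} (h : y' = y - η * n) :
    n ^ 2 ≤ 2 * (y ^ 2 + y' ^ 2) / η ^ 2 := by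
  rw [le_div_iff₀ (by positivity), h]
  nlinarith [sq_nonneg (y + (y - η * n))]

/-- The squared means of a mode evolve as second moments with a negative noise intensity. -/
lemma isMomentSeq_mean (hη : 0 < η) (hβ0 : 0 ≤ β) (hβ1 : β < 1) (hindep : iIndepFun u ℙr)
    (hlaw : ∀ t, HasLaw (u t) (stdGaussian (Vec d)) ℙr)
    (hA : ∀ x y, inner ℝ (A x) y = inner ℝ x (A y)) (hAb : A b = lam • a)
    (hB : ∀ m, inner ℝ a (B m) = inner ℝ b m)
    {X : ℕ → Ω → Vec d × Vec d} (hX : X = fun t ω => zoState A B β η w0 (fun s => u s ω) t) :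
    IsMomentSeq η β lam (fun t => (∫ ω, inner ℝ a (X t ω).1 ∂ℙr) ^ 2)
      (fun t => (∫ ω, inner ℝ a (X t ω).1 ∂ℙr) * ∫ ω, inner ℝ b (X t ω).2 ∂ℙr)
      (fun t => (∫ ω, inner ℝ b (X t ω).2 ∂ℙr) ^ 2)
      (fun t => -(lam ^ 2 * (∫ ω, inner ℝ a (X t ω).1 ∂ℙr) ^ 2)) := by
  have hXs (t : ℕ) (ω : Ω) : X (t + 1) ω = zoStep A B β η (X t ω) (u t ω) := by rw [hX]; rfl
  have hL (t : ℕ) : MemLp (fun ω => (X t ω).1) 2 ℙr ∧ MemLp (fun ω => (X t ω).2) 2 ℙr := by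
    rw [hX]; exact memLp_zoState hβ0 hβ1 hindep hlaw t
  have hn (t : ℕ) := (moments_succ hβ0 hβ1 hindep hlaw hA hAb t hX).1
  have hy (t : ℕ) : ∫ ω, inner ℝ a (X (t + 1) ω).1 ∂ℙr =
      ∫ ω, inner ℝ a (X t ω).1 ∂ℙr - η * ∫ ω, inner ℝ b (X (t + 1) ω).2 ∂ℙr := by
    have ha : MemLp (fun ω => inner ℝ a (X t ω).1) 2 ℙr := (innerSL ℝ a).comp_memLp' (hL t).1
    have hb : MemLp (fun ω => inner ℝ b (X (t + 1) ω).2) 2 ℙr :=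
      (innerSL ℝ b).comp_memLp' (hL (t + 1)).2
    rw [← integral_const_mul, ← integral_sub (ha.integrable one_le_two)
      ((hb.integrable one_le_two).const_mul _)]
    congr 1
    ext ω
    rw [hXs, inner_zoStep_fst hB]
  have hM0 : ∫ ω, inner ℝ b (X 0 ω).2 ∂ℙr = 0 := by simp [hX, zoState]
  constructor
  -- The choice `S = -lam ^ 2 * Y` leaves `lam ^ 2 * Y` out of `S + 2 * lam ^ 2 * Y`, which
  -- completes the square of the mean recursion.
  · intro t; rw [hn]; ring
  · intro t; rw [hy, hn]; ring
  · intro t; rw [hy, hn]; ring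
  · rw [hM0, mul_zero]
  · rw [hM0]; ring
  · exact fun t => sq_nonneg _
  · exact fun t => sq_nonneg _
  · exact fun t => abs_mul_le_half_add_sq _ _
  · exact fun t => momentum_sq_le hη (hy t)
  · exact fun hrem t => lyap_sq_nonneg hrem _ _

/-- The recursions come from `moments_succ` and `y' = y - η n'`; the inequalities hold pointwise and
are integrated. The noise still involves all of `A w`, so a single mode is not closed. -/
lemma isMomentSeq_meanSquare (hη : 0 < η) (hβ0 : 0 ≤ β) (hβ1 : β < 1) (hindep : iIndepFun u ℙr)
    (hlaw : ∀ t, HasLaw (u t) (stdGaussian (Vec d)) ℙr)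
    (hA : ∀ x y, inner ℝ (A x) y = inner ℝ x (A y)) (hAb : A b = lam • a)
    (hB : ∀ m, inner ℝ a (B m) = inner ℝ b m)
    {X : ℕ → Ω → Vec d × Vec d} (hX : X = fun t ω => zoState A B β η w0 (fun s => u s ω) t) :
    IsMomentSeq η β lam (fun t => ∫ ω, inner ℝ a (X t ω).1 ^ 2 ∂ℙr)
      (fun t => ∫ ω, inner ℝ a (X t ω).1 * inner ℝ b (X t ω).2 ∂ℙr)
      (fun t => ∫ ω, inner ℝ b (X t ω).2 ^ 2 ∂ℙr)
      (fun t => ∫ ω, ‖b‖ ^ 2 * ‖A (X t ω).1‖ ^ 2 ∂ℙr) := by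
  have hXs (t : ℕ) (ω : Ω) : X (t + 1) ω = zoStep A B β η (X t ω) (u t ω) := by rw [hX]; rfl
  have hL (t : ℕ) : MemLp (fun ω => (X t ω).1) 2 ℙr ∧ MemLp (fun ω => (X t ω).2) 2 ℙr := by
    rw [hX]; exact memLp_zoState hβ0 hβ1 hindep hlaw t
  have ha (t : ℕ) : MemLp (fun ω => inner ℝ a (X t ω).1) 2 ℙr := (innerSL ℝ a).comp_memLp' (hL t).1
  have hb (t : ℕ) : MemLp (fun ω => inner ℝ b (X t ω).2) 2 ℙr := (innerSL ℝ b).comp_memLp' (hL t).2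
  have haa (t : ℕ) := (ha t).integrable_sq
  have hbb (t : ℕ) := (hb t).integrable_sq
  have hab (s t : ℕ) : Integrable (fun ω => inner ℝ a (X s ω).1 * inner ℝ b (X t ω).2) ℙr :=
    (ha s).integrable_mul (hb t)
  have hM (t : ℕ) := (moments_succ hβ0 hβ1 hindep hlaw hA hAb t hX).2.2
  have hC (t : ℕ) := (moments_succ hβ0 hβ1 hindep hlaw hA hAb t hX).2.1
  have hy (t : ℕ) (ω : Ω) : inner ℝ a (X (t + 1) ω).1 =
      inner ℝ a (X t ω).1 - η * inner ℝ b (X (t + 1) ω).2 := by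
    rw [hXs, inner_zoStep_fst hB]
  constructor
  · exact hM
  · intro t
    rw [← hC, ← integral_const_mul, ← integral_sub (hab _ _) ((hbb _).const_mul _)]
    congr 1
    ext ω
    rw [hy]
    ring
  · intro t
    have hsub : Integrable (fun ω => inner ℝ a (X t ω).1 ^ 2 -
        2 * η * (inner ℝ a (X t ω).1 * inner ℝ b (X (t + 1) ω).2)) ℙr :=
      (haa t).sub ((hab t (t + 1)).const_mul (2 * η))
    rw [← hC, ← integral_const_mul, ← integral_const_mul,
      ← integral_sub (haa _) ((hab _ _).const_mul _), ← integral_add hsub ((hbb _).const_mul _)]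
    congr 1
    ext ω
    rw [hy]
    ring
  · simp [hX, zoState]
  · simp [hX, zoState]
  · exact fun t => integral_nonneg fun ω => sq_nonneg _
  · exact fun t => integral_nonneg fun ω => sq_nonneg _
  · intro t
    refine (abs_integral_le_integral_abs).trans ?_
    rw [← integral_add (haa t) (hbb t), ← integral_div]
    exact integral_mono (hab t t).abs (((haa t).fun_add (hbb t)).div_const 2)
      fun ω => abs_mul_le_half_add_sq _ _
  · intro t
    rw [← integral_add (haa t) (haa (t + 1)), ← integral_const_mul, ← integral_div]
    exact integral_mono (hbb (t + 1)) ((((haa t).fun_add (haa (t + 1))).const_mul 2).div_const _)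
      fun ω => momentum_sq_le hη (hy t ω)
  · intro hrem t
    have h : 0 ≤ ∫ ω, lyap η β lam (inner ℝ a (X t ω).1 ^ 2)
        (inner ℝ a (X t ω).1 * inner ℝ b (X t ω).2) (inner ℝ b (X t ω).2 ^ 2) ∂ℙr :=
      integral_nonneg fun ω => lyap_sq_nonneg hrem _ _
    unfold lyap at h ⊢
    rwa [integral_add (((haa t).const_mul _).fun_add ((hab t t).const_mul _)) ((hbb t).const_mul _),
      integral_add ((haa t).const_mul _) ((hab t t).const_mul _), integral_const_mul,
      integral_const_mul, integral_const_mul] at h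

end Trajectory

end ZOAdam
end

/-! ### The characteristic equation of the critical step size. -/

noncomputable section

namespace ZOAdam

section Critical

variable {ι : Type*} [Fintype ι] {lam : ι → ℝ} {β : ℝ}

lemma gain_le_gain {η η' l : ℝ} (hβ0 : 0 ≤ β) (hη : 0 ≤ η) (hlt : η ≤ η') (hl : 0 ≤ l)
    (h : η' * l < 1 + β) : gain η β l ≤ gain η' β l := by
  have h1 := one_sub_div_pos hβ0 h
  have h2 : η * l ≤ η' * l := by gcongr
  have h3 : 0 ≤ η' * l := mul_nonneg (hη.trans hlt) hl
  unfold gain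
  gcongr

lemma gain_lt_gain {η η' l : ℝ} (hβ0 : 0 ≤ β) (hη : 0 ≤ η) (hlt : η < η') (hl : 0 < l)
    (h : η' * l < 1 + β) : gain η β l < gain η' β l := by
  have h1 := one_sub_div_pos hβ0 h
  have h2 : η * l < η' * l := by gcongr
  have h3 : 0 ≤ η * l := mul_nonneg hη hl.le
  unfold gain
  refine div_lt_div₀ h2 ?_ (h3.trans h2.le) (by positivity)
  gcongr

lemma sum_gain_lt {η η' : ℝ} (hβ0 : 0 ≤ β) (hlam : ∀ i, 0 ≤ lam i) {i0 : ι}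
    (hmax : ∀ i, lam i ≤ lam i0) (hi0 : 0 < lam i0) (hη : 0 ≤ η) (hlt : η < η')
    (h : η' * lam i0 < 1 + β) : ∑ i, gain η β (lam i) < ∑ i, gain η' β (lam i) := by
  have hi (i : ι) : η' * lam i < 1 + β :=
    (mul_le_mul_of_nonneg_left (hmax i) (hη.trans hlt.le)).trans_lt h
  exact Finset.sum_lt_sum (fun i _ => gain_le_gain hβ0 hη hlt.le (hlam i) (hi i))
    ⟨i0, Finset.mem_univ _, gain_lt_gain hβ0 hη hlt hi0 h⟩

lemma exists_sum_gain_eq_one (hβ0 : 0 ≤ β) (hlam : ∀ i, 0 ≤ lam i) {i0 : ι}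
    (hmax : ∀ i, lam i ≤ lam i0) (hi0 : 0 < lam i0) :
    ∃ η, 0 < η ∧ η * lam i0 < 1 + β ∧ ∑ i, gain η β (lam i) = 1 := by
  -- The step size at which the top mode alone has gain `1`. It lies below the pole, so the
  -- intermediate value theorem applies on `[0, T]`.
  set T := 2 * (1 + β) / ((3 + β) * lam i0) with hT
  have hT0 : 0 < T := by positivity
  have hTl : T * lam i0 = (1 + β) * (2 / (3 + β)) := by rw [hT]; field_simp
  have hTlt : T * lam i0 < 1 + β := by
    rw [hTl]
    have : 2 / (3 + β) < 1 := by rw [div_lt_one (by positivity)]; linarith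
    nlinarith
  have hlt (η : ℝ) (h0 : 0 ≤ η) (hη : η ≤ T) (i : ι) : η * lam i < 1 + β :=
    (mul_le_mul hη (hmax i) (hlam i) hT0.le).trans_lt hTlt
  have hcont : ContinuousOn (fun η => ∑ i, gain η β (lam i)) (Set.Icc 0 T) := by
    refine continuousOn_finsetSum _ fun i _ => ?_
    unfold gain
    refine ContinuousOn.div (by fun_prop) (by fun_prop) fun η hη => ?_
    have := one_sub_div_pos hβ0 (hlt η hη.1 hη.2 i)
    positivity
  have hF0 : ∑ i, gain 0 β (lam i) = 0 := by simp [gain]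
  have hg : gain T β (lam i0) = 1 := by
    unfold gain
    have h3 : (3 + β) ≠ 0 := by positivity
    have h1 : 1 + β ≠ 0 := by positivity
    have : 1 - (1 + β) * (2 / (3 + β)) / (1 + β) = (1 + β) / (3 + β) := by
      field_simp
      ring
    rw [hTl, this]
    field_simp
  have hFT : 1 ≤ ∑ i, gain T β (lam i) := by
    rw [← hg]
    exact Finset.single_le_sum (f := fun i => gain T β (lam i))
      (fun i _ => gain_nonneg hT0 hβ0 (hlam i) (hlt T hT0.le le_rfl i)) (Finset.mem_univ i0)
  obtain ⟨η, hη, h1⟩ := intermediate_value_Icc hT0.le hcont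
    (show (1 : ℝ) ∈ Set.Icc _ _ from ⟨by rw [hF0]; norm_num, hFT⟩)
  have hη0 : η ≠ 0 := by
    rintro rfl
    simp only [hF0] at h1
    norm_num at h1
  exact ⟨η, lt_of_le_of_ne hη.1 hη0.symm, hlt η hη.1 hη.2 i0, h1⟩

/-- Every denominator in the equation lies between that of the top mode and `2`; replacing all of
them by either extreme makes the equation explicitly solvable. -/
lemma critical_bounds {η : ℝ} (hβ0 : 0 ≤ β) (hlam : ∀ i, 0 ≤ lam i) {i0 : ι}
    (hmax : ∀ i, lam i ≤ lam i0) (hi0 : 0 < lam i0) (hη : 0 < η) (hlt : η * lam i0 < 1 + β)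
    (h1 : ∑ i, gain η β (lam i) = 1) :
    2 / (∑ i, lam i + 2 * lam i0 / (1 + β)) ≤ η ∧ η ≤ 2 / ∑ i, lam i := by
  have hsum : 0 < ∑ i, lam i := Finset.sum_pos' (fun i _ => hlam i) ⟨i0, Finset.mem_univ _, hi0⟩
  have h0 := one_sub_div_pos hβ0 hlt
  have hle (i : ι) : η * lam i / (1 + β) ≤ η * lam i0 / (1 + β) := by
    gcongr
    exact hmax i
  constructor
  · rw [div_le_iff₀ (by positivity)]
    have h2 : (1 : ℝ) ≤ ∑ i, η * lam i / (2 * (1 - η * lam i0 / (1 + β))) := by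
      refine h1.ge.trans (Finset.sum_le_sum fun i _ => ?_)
      exact div_le_div_of_nonneg_left (mul_nonneg hη.le (hlam i)) (by positivity)
        (by linarith [hle i])
    rw [← Finset.sum_div, ← Finset.mul_sum, one_le_div (by positivity)] at h2
    have h3 : η * (2 * lam i0 / (1 + β)) = 2 * (η * lam i0 / (1 + β)) := by ring
    rw [mul_add, h3]
    linarith
  · rw [le_div_iff₀ hsum]
    have h2 : ∑ i, η * lam i / 2 ≤ (1 : ℝ) := by
      rw [← h1]
      refine Finset.sum_le_sum fun i _ => ?_
      have h3 := mul_nonneg hη.le (hlam i)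
      have h4 : 0 < 1 - η * lam i / (1 + β) := by linarith [hle i]
      have h5 : 0 ≤ η * lam i / (1 + β) := by positivity
      unfold gain
      gcongr
      linarith
    rw [← Finset.sum_div, ← Finset.mul_sum] at h2
    linarith

lemma isLUB_of_threshold {p : ℝ → Prop} {c : ℝ} (hc : 0 < c) (h1 : ∀ η, 0 < η → η < c → p η)
    (h2 : ∀ η, c < η → ¬ p η) : IsLUB {η | 0 < η ∧ p η} c := by
  constructor
  · rintro η ⟨_, hp⟩
    by_contra hlt
    exact h2 η (not_le.1 hlt) hp
  · intro x hx
    by_contra hlt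
    rw [not_le] at hlt
    obtain ⟨y, hy1, hy2⟩ := exists_between (max_lt hlt hc)
    have := hx ⟨(le_max_right _ _).trans_lt hy1, h1 y ((le_max_right _ _).trans_lt hy1) hy2⟩
    linarith [le_max_left x 0]

end Critical

/-! ### Generalized eigenvectors and reduction of the optimizer to linear dynamics. -/

section Linear

variable {d : ℕ}

lemma toEuclideanLin_mul_apply (M N : Matrix (Fin d) (Fin d) ℝ) (v : Vec d) :
    Matrix.toEuclideanLin (M * N) v = Matrix.toEuclideanLin M (Matrix.toEuclideanLin N v) := by
  simp [Matrix.toLpLin_apply, Matrix.mulVec_mulVec]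

lemma inner_toEuclideanLin (M : Matrix (Fin d) (Fin d) ℝ) (x y : Vec d) :
    inner ℝ (Matrix.toEuclideanLin M x) y = inner ℝ x (Matrix.toEuclideanLin Mᴴ y) := by
  rw [Matrix.toEuclideanLin_conjTranspose_eq_adjoint, LinearMap.adjoint_inner_right]

lemma inner_toEuclideanLin_pos {P : Matrix (Fin d) (Fin d) ℝ} (hP : P.PosDef) {x : Vec d}
    (hx : x ≠ 0) : 0 < inner ℝ x (Matrix.toEuclideanLin P x) := by
  have h := hP.dotProduct_mulVec_pos (x := x.ofLp) (by simpa using hx)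
  rw [EuclideanSpace.inner_eq_star_dotProduct, Matrix.toLpLin_apply, dotProduct_comm]
  exact h

lemma toEuclideanLin_eigenvectorBasis {Q : Matrix (Fin d) (Fin d) ℝ} (hQ : Q.IsHermitian)
    (i : Fin d) : Matrix.toEuclideanLin Q (hQ.eigenvectorBasis i) =
      hQ.eigenvalues i • hQ.eigenvectorBasis i := by
  rw [Matrix.toLpLin_apply, hQ.mulVec_eigenvectorBasis]
  rfl

lemma span_range_orthonormalBasis (e : OrthonormalBasis (Fin d) ℝ (Vec d)) :
    Submodule.span ℝ (Set.range e) = ⊤ := by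
  rw [← OrthonormalBasis.coe_toBasis]
  exact Module.Basis.span_eq _

lemma ne_zero_of_span_eq_top {b : Fin d → Vec d} (hb : Submodule.span ℝ (Set.range b) = ⊤)
    (i : Fin d) : b i ≠ 0 :=
  (linearIndependent_of_top_le_span_of_card_eq_finrank hb.ge (by simp)).ne_zero i

/-- A spanning family of generalized eigenvectors of the pair `(H, P)`. -/
lemma exists_generalized_eigenvectors {H P : Matrix (Fin d) (Fin d) ℝ} (hH : H.PosSemidef)
    (hP : P.PosDef) : ∃ (lam : Fin d → ℝ) (b : Fin d → Vec d),
      (∀ i, Matrix.toEuclideanLin H (b i) = lam i • Matrix.toEuclideanLin P (b i)) ∧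
      Submodule.span ℝ (Set.range b) = ⊤ ∧ (∀ i, 0 ≤ lam i) ∧
      eigs (P⁻¹ * H) = Finset.univ.val.map lam := by
  -- The factor `R` symmetrizes the problem: `P⁻¹ * H` is similar to the positive semidefinite
  -- `(R⁻¹)ᴴ * H * R⁻¹`, whose eigenvectors are pulled back by `R⁻¹`.
  obtain ⟨R, hR⟩ : ∃ R : Matrix (Fin d) (Fin d) ℝ, P = Rᴴ * R := by
    open scoped MatrixOrder in
    exact CStarAlgebra.nonneg_iff_eq_star_mul_self.mp hP.posSemidef.nonneg
  have hRu : IsUnit R.det := by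
    have h := (Matrix.isUnit_iff_isUnit_det _).1 hP.isUnit
    rw [hR, Matrix.det_mul] at h
    exact isUnit_of_mul_isUnit_right h
  have hRR : R * R⁻¹ = 1 := Matrix.mul_nonsing_inv _ hRu
  have hRR' : R⁻¹ * R = 1 := Matrix.nonsing_inv_mul _ hRu
  have hRH : Rᴴ * (R⁻¹)ᴴ = 1 := by rw [← Matrix.conjTranspose_mul, hRR', Matrix.conjTranspose_one]
  have hQ : ((R⁻¹)ᴴ * H * R⁻¹).PosSemidef := hH.conjTranspose_mul_mul_same _
  have hPinv : P⁻¹ = R⁻¹ * (R⁻¹)ᴴ := by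
    apply Matrix.inv_eq_right_inv
    rw [hR]
    calc Rᴴ * R * (R⁻¹ * (R⁻¹)ᴴ) = Rᴴ * (R * R⁻¹) * (R⁻¹)ᴴ := by simp only [Matrix.mul_assoc]
      _ = 1 := by rw [hRR, Matrix.mul_one, hRH]
  refine ⟨hQ.1.eigenvalues, fun i => Matrix.toEuclideanLin R⁻¹ (hQ.1.eigenvectorBasis i),
    fun i => ?_, ?_, fun i => hQ.eigenvalues_nonneg i, ?_⟩
  · have h1 : H * R⁻¹ = Rᴴ * ((R⁻¹)ᴴ * H * R⁻¹) := by
      calc H * R⁻¹ = (Rᴴ * (R⁻¹)ᴴ) * H * R⁻¹ := by rw [hRH, Matrix.one_mul]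
        _ = _ := by simp only [Matrix.mul_assoc]
    have h2 : P * R⁻¹ = Rᴴ := by rw [hR, Matrix.mul_assoc, hRR, Matrix.mul_one]
    rw [← toEuclideanLin_mul_apply, ← toEuclideanLin_mul_apply, h1, h2,
      toEuclideanLin_mul_apply, toEuclideanLin_eigenvectorBasis, map_smul]
  · have h1 : Set.range (fun i => Matrix.toEuclideanLin R⁻¹ (hQ.1.eigenvectorBasis i)) =
        Matrix.toEuclideanLin R⁻¹ '' Set.range hQ.1.eigenvectorBasis := by
      rw [← Set.range_comp]; rfl
    rw [h1, ← Submodule.map_span, span_range_orthonormalBasis, Submodule.map_top,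
      LinearMap.range_eq_top]
    intro x
    refine ⟨Matrix.toEuclideanLin R x, ?_⟩
    rw [← toEuclideanLin_mul_apply, hRR']
    simp
  · have h1 : (P⁻¹ * H).charpoly = ((R⁻¹)ᴴ * H * R⁻¹).charpoly := by
      rw [hPinv, Matrix.mul_assoc, Matrix.charpoly_mul_comm]
    unfold eigs
    rw [h1, hQ.1.roots_charpoly_eq_eigenvalues]
    rfl

/-- If `H` and `P` commute, the generalized eigenvectors can be chosen orthonormal. -/
lemma exists_orthonormal_eigenvectors {H P : Matrix (Fin d) (Fin d) ℝ} (hH : H.IsHermitian)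
    (hP : P.PosDef) (hcomm : P * H = H * P) :
    ∃ (lam : Fin d → ℝ) (b : OrthonormalBasis (Fin d) ℝ (Vec d)),
      (∀ i, Matrix.toEuclideanLin H (b i) = lam i • Matrix.toEuclideanLin P (b i)) ∧
      eigs (P⁻¹ * H) = Finset.univ.val.map lam ∧ (P⁻¹ * H).trace = ∑ i, lam i := by
  have hPu := (Matrix.isUnit_iff_isUnit_det _).1 hP.isUnit
  have h1 : P⁻¹ * H = H * P⁻¹ := by
    calc P⁻¹ * H = P⁻¹ * (H * P) * P⁻¹ := by
          rw [Matrix.mul_assoc, Matrix.mul_assoc, Matrix.mul_nonsing_inv _ hPu, Matrix.mul_one]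
      _ = H * P⁻¹ := by
          rw [← hcomm, ← Matrix.mul_assoc P⁻¹, Matrix.nonsing_inv_mul _ hPu, Matrix.one_mul]
  -- Commutation makes `P⁻¹ * H` itself symmetric, so its ordinary orthonormal eigenbasis serves.
  have hA : (P⁻¹ * H).IsHermitian := by
    unfold Matrix.IsHermitian
    rw [Matrix.conjTranspose_mul, hH.eq, hP.1.inv.eq, h1]
  refine ⟨hA.eigenvalues, hA.eigenvectorBasis, fun i => ?_, ?_, ?_⟩
  · have h2 (v : Vec d) : Matrix.toEuclideanLin H v =
        Matrix.toEuclideanLin P (Matrix.toEuclideanLin (P⁻¹ * H) v) := by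
      rw [← toEuclideanLin_mul_apply, ← Matrix.mul_assoc, Matrix.mul_nonsing_inv _ hPu,
        Matrix.one_mul]
    rw [h2, toEuclideanLin_eigenvectorBasis, map_smul]
  · exact hA.roots_charpoly_eq_eigenvalues
  · simpa using hA.trace_eq_sum_eigenvalues

/-- If all mode coordinates of `w` vanish, `P w` is orthogonal to a spanning set, so `⟨P w, w⟩ = 0`
and `w = 0`. An injective linear map in finite dimension is bounded below. -/
lemma exists_norm_sq_le {P : Matrix (Fin d) (Fin d) ℝ} (hP : P.PosDef) {b : Fin d → Vec d}
    (hb : Submodule.span ℝ (Set.range b) = ⊤) : ∃ K : ℝ, 0 ≤ K ∧ ∀ w : Vec d,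
      ‖w‖ ^ 2 ≤ K * ∑ i, inner ℝ (Matrix.toEuclideanLin P (b i)) w ^ 2 := by
  let T : Vec d →ₗ[ℝ] Vec d := (WithLp.linearEquiv 2 ℝ (Fin d → ℝ)).symm.toLinearMap ∘ₗ
    LinearMap.pi fun i => (innerSL ℝ (Matrix.toEuclideanLin P (b i))).toLinearMap
  have hT (w : Vec d) (i : Fin d) : T w i = inner ℝ (Matrix.toEuclideanLin P (b i)) w := rfl
  have hker : T.ker = ⊥ := by
    rw [LinearMap.ker_eq_bot']
    intro w hw
    by_contra hne
    have h1 : (innerSL ℝ (Matrix.toEuclideanLin P w)).toLinearMap = 0 := by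
      refine LinearMap.ext_on_range hb fun i => ?_
      have := hT w i
      rw [hw, inner_toEuclideanLin, hP.1.eq] at this
      change inner ℝ (Matrix.toEuclideanLin P w) (b i) = 0
      rw [real_inner_comm, ← this]
      rfl
    have h2 := LinearMap.congr_fun h1 w
    change inner ℝ (Matrix.toEuclideanLin P w) w = 0 at h2
    rw [real_inner_comm] at h2
    exact (inner_toEuclideanLin_pos hP hne).ne' h2
  obtain ⟨K, -, hK⟩ := T.exists_antilipschitzWith hker
  refine ⟨(K : ℝ) ^ 2, by positivity, fun w => ?_⟩
  have h1 : ‖w‖ ≤ K * ‖T w‖ := by simpa using hK.le_mul_dist w 0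
  have h2 : ‖T w‖ ^ 2 = ∑ i, inner ℝ (Matrix.toEuclideanLin P (b i)) w ^ 2 := by
    rw [EuclideanSpace.norm_sq_eq]
    simp [hT]
  calc ‖w‖ ^ 2 ≤ (K * ‖T w‖) ^ 2 := by gcongr
    _ = _ := by rw [mul_pow, h2]

/-- A central difference is exact on quadratics, since the even terms in `μ` cancel. This removes
`μ` from the dynamics. -/
lemma twoPointEstimator_quadModel (f : Vec d → ℝ) (xstar : Vec d)
    (hH : (hessian f xstar).IsHermitian) {μ : ℝ} (hμ : 0 < μ) (v x : Vec d) :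
    twoPointEstimator (quadModel f xstar) μ v x =
      (inner ℝ v (Matrix.toEuclideanLin (hessian f xstar) (x - xstar)) : ℝ) • v := by
  have h1 : x + μ • v - xstar = (x - xstar) + μ • v := by abel
  have h2 : x - μ • v - xstar = (x - xstar) - μ • v := by abel
  have h3 (y : Vec d) : inner ℝ y (Matrix.toEuclideanLin (hessian f xstar) v) =
      inner ℝ v (Matrix.toEuclideanLin (hessian f xstar) y) := by
    rw [real_inner_comm, inner_toEuclideanLin, hH.eq]
  unfold twoPointEstimator quadModel
  congr 1
  rw [h1, h2]
  generalize x - xstar = w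
  simp only [map_add, map_sub, map_smul, inner_add_left, inner_add_right, inner_sub_left,
    inner_sub_right, real_inner_smul_left, real_inner_smul_right, h3 w]
  field_simp
  ring

/-- The Hessian or preconditioner as a continuous linear map. -/
abbrev toCLM (M : Matrix (Fin d) (Fin d) ℝ) : Vec d →L[ℝ] Vec d :=
  LinearMap.toContinuousLinearMap (Matrix.toEuclideanLin M)

lemma frozenZOAdam_sub (f : Vec d → ℝ) (xstar : Vec d) (hH : (hessian f xstar).IsHermitian)
    {μ : ℝ} (hμ : 0 < μ) (β : ℝ) (P : Matrix (Fin d) (Fin d) ℝ) {Ω : Type*}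
    (u : ℕ → Ω → Vec d) (η : ℝ) (x0 : Vec d) (t : ℕ) (ω : Ω) :
    frozenZOAdam (quadModel f xstar) μ β P u η x0 t ω - xstar =
      (zoState (toCLM (hessian f xstar)) (toCLM P⁻¹) β η (x0 - xstar) (fun s => u s ω) t).1 := by
  have h : frozenZOAdamState (quadModel f xstar) μ β P η (fun s => u s ω) x0 t =
      ((zoState (toCLM (hessian f xstar)) (toCLM P⁻¹) β η (x0 - xstar) (fun s => u s ω) t).1 +
        xstar,
      (zoState (toCLM (hessian f xstar)) (toCLM P⁻¹) β η (x0 - xstar) (fun s => u s ω) t).2) := by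
    induction t with
    | zero => simp [frozenZOAdamState, zoState]
    | succ t ih =>
      simp only [frozenZOAdamState, zoState, ih, zoStep, twoPointEstimator_quadModel f xstar hH hμ,
        add_sub_cancel_right, LinearMap.coe_toContinuousLinearMap']
      congr 1
      abel
  unfold frozenZOAdam
  rw [h, add_sub_cancel_right]

lemma lambdaMax_eq {A : Matrix (Fin d) (Fin d) ℝ} {lam : Fin d → ℝ}
    (h : eigs A = Finset.univ.val.map lam) {i0 : Fin d} (hmax : ∀ i, lam i ≤ lam i0) :
    lambdaMax A = lam i0 := by
  refine IsGreatest.csSup_eq ⟨?_, ?_⟩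
  · simp [h]
  · intro l hl
    rw [Set.mem_ofPred_eq, h, Multiset.mem_map] at hl
    obtain ⟨i, -, rfl⟩ := hl
    exact hmax i

lemma exists_max_pos {H P : Matrix (Fin d) (Fin d) ℝ} (hne : H ≠ 0) {lam : Fin d → ℝ}
    {b : Fin d → Vec d}
    (hHb : ∀ i, Matrix.toEuclideanLin H (b i) = lam i • Matrix.toEuclideanLin P (b i))
    (hb : Submodule.span ℝ (Set.range b) = ⊤) (hlam : ∀ i, 0 ≤ lam i) :
    ∃ i0, (∀ i, lam i ≤ lam i0) ∧ 0 < lam i0 := by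
  obtain ⟨j, hj⟩ : ∃ j, lam j ≠ 0 := by
    by_contra! hall
    refine hne (Matrix.toEuclideanLin.injective ?_)
    rw [map_zero]
    refine LinearMap.ext_on_range hb fun i => ?_
    rw [hHb, hall]
    simp
  have : Nonempty (Fin d) := ⟨j⟩
  obtain ⟨i0, hi0⟩ := Finite.exists_max lam
  exact ⟨i0, hi0, ((hlam j).lt_of_ne hj.symm).trans_le (hi0 j)⟩

end Linear

end ZOAdam
end

/-! ### Stability and instability of the optimizer. -/

noncomputable section

namespace ZOAdam

variable {d : ℕ} {f : Vec d → ℝ} {xstar : Vec d} {P : Matrix (Fin d) (Fin d) ℝ} {β μ η : ℝ}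
  {Ω : Type*} [MeasurableSpace Ω] {ℙr : Measure Ω} [IsProbabilityMeasure ℙr]
  {u : ℕ → Ω → Vec d} {lam : Fin d → ℝ} {b : Fin d → Vec d}

lemma toCLM_symm {H : Matrix (Fin d) (Fin d) ℝ} (hH : H.IsHermitian) (x y : Vec d) :
    inner ℝ (toCLM H x) y = inner ℝ x (toCLM H y) := by
  have h := inner_toEuclideanLin H x y
  rwa [hH.eq] at h

lemma inner_toCLM_inv (hP : P.PosDef) (c m : Vec d) :
    inner ℝ (Matrix.toEuclideanLin P c) (toCLM P⁻¹ m) = inner ℝ c m := by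
  have hPu := (Matrix.isUnit_iff_isUnit_det _).1 hP.isUnit
  rw [inner_toEuclideanLin, hP.1.eq]
  simp only [LinearMap.coe_toContinuousLinearMap']
  rw [← toEuclideanLin_mul_apply, Matrix.mul_nonsing_inv _ hPu]
  simp

lemma memLp_frozenZOAdam (hH : (hessian f xstar).IsHermitian) (hβ0 : 0 ≤ β) (hβ1 : β < 1)
    (hμ : 0 < μ) (hindep : iIndepFun u ℙr)
    (hlaw : ∀ t, HasLaw (u t) (stdGaussian (Vec d)) ℙr) (x0 : Vec d) (t : ℕ) :
    MemLp (fun ω => frozenZOAdam (quadModel f xstar) μ β P u η x0 t ω - xstar) 2 ℙr := by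
  simp only [frozenZOAdam_sub f xstar hH hμ]
  exact (memLp_zoState hβ0 hβ1 hindep hlaw t).1

lemma inner_integral_sub (hH : (hessian f xstar).IsHermitian) (hβ0 : 0 ≤ β) (hβ1 : β < 1)
    (hμ : 0 < μ) (hindep : iIndepFun u ℙr)
    (hlaw : ∀ t, HasLaw (u t) (stdGaussian (Vec d)) ℙr) (x0 : Vec d) (t : ℕ) (c : Vec d) :
    inner ℝ c (∫ ω, (frozenZOAdam (quadModel f xstar) μ β P u η x0 t ω - xstar) ∂ℙr) =
      ∫ ω, inner ℝ c (zoState (toCLM (hessian f xstar)) (toCLM P⁻¹) β η (x0 - xstar)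
        (fun s => u s ω) t).1 ∂ℙr := by
  have h := (innerSL ℝ c).integral_comp_comm
    ((memLp_frozenZOAdam (P := P) (η := η) hH hβ0 hβ1 hμ hindep hlaw x0 t).integrable one_le_two)
  simp only [innerSL_apply_apply] at h
  rw [← h]
  simp only [frozenZOAdam_sub f xstar hH hμ]

lemma stableInMean_of_lt (hH : (hessian f xstar).IsHermitian) (hP : P.PosDef)
    (hHb : ∀ i, Matrix.toEuclideanLin (hessian f xstar) (b i) =
      lam i • Matrix.toEuclideanLin P (b i))
    (hb : Submodule.span ℝ (Set.range b) = ⊤) (hlam : ∀ i, 0 ≤ lam i)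
    (hβ0 : 0 ≤ β) (hβ1 : β < 1) (hμ : 0 < μ) (hindep : iIndepFun u ℙr)
    (hlaw : ∀ t, HasLaw (u t) (stdGaussian (Vec d)) ℙr) (hη : 0 < η)
    (hlt : ∀ i, η * lam i * (1 - β) < 2 * (1 + β)) :
    StableInMean ℙr xstar (frozenZOAdam (quadModel f xstar) μ β P u η) := by
  intro x0
  refine ⟨fun t => (memLp_frozenZOAdam hH hβ0 hβ1 hμ hindep hlaw x0 t).integrable one_le_two, ?_⟩
  have hbd (i : Fin d) := (isMomentSeq_mean (w0 := x0 - xstar) hη hβ0 hβ1 hindep hlaw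
    (toCLM_symm hH) (hHb i) (inner_toCLM_inv hP (b i)) rfl).bddAbove_of_noiseless hη hβ0 hβ1
    (hlam i) (hlt i)
  choose B hB using hbd
  obtain ⟨K, hK0, hK⟩ := exists_norm_sq_le hP hb
  refine ⟨√(K * ∑ i, B i), ?_⟩
  rintro _ ⟨t, rfl⟩
  refine Real.le_sqrt_of_sq_le ((hK _).trans ?_)
  gcongr with i
  rw [inner_integral_sub hH hβ0 hβ1 hμ hindep hlaw]
  exact hB i ⟨t, rfl⟩

lemma not_stableInMean_of_lt (hH : (hessian f xstar).IsHermitian) (hP : P.PosDef)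
    {i : Fin d} (hHb : Matrix.toEuclideanLin (hessian f xstar) (b i) =
      lam i • Matrix.toEuclideanLin P (b i)) (hbi : b i ≠ 0) (hlam : 0 < lam i)
    (hβ0 : 0 ≤ β) (hβ1 : β < 1) (hμ : 0 < μ) (hindep : iIndepFun u ℙr)
    (hlaw : ∀ t, HasLaw (u t) (stdGaussian (Vec d)) ℙr) (hη : 0 < η)
    (hlt : 2 * (1 + β) < η * lam i * (1 - β)) :
    ¬ StableInMean ℙr xstar (frozenZOAdam (quadModel f xstar) μ β P u η) := by
  intro hst
  -- Displacing the start along `b i` makes the initial mode coordinate `⟨P (b i), b i⟩`, which is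
  -- positive.
  obtain ⟨K, hK⟩ := (hst (xstar + b i)).2
  have hmom := isMomentSeq_mean (w0 := xstar + b i - xstar) hη hβ0 hβ1 hindep hlaw
    (toCLM_symm hH) hHb (inner_toCLM_inv hP (b i)) rfl
  refine hmom.not_bddAbove_of_noiseless hη hβ0 hβ1 hlam hlt ?_
    ⟨(‖Matrix.toEuclideanLin P (b i)‖ * K) ^ 2, ?_⟩
  · have h := inner_toEuclideanLin_pos hP hbi
    rw [real_inner_comm] at h
    simp only [zoState, add_sub_cancel_left, integral_const, probReal_univ, one_smul]
    positivity
  · rintro _ ⟨t, rfl⟩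
    beta_reduce
    rw [← inner_integral_sub hH hβ0 hβ1 hμ hindep hlaw]
    refine sq_le_sq.2 (((abs_real_inner_le_norm _ _).trans ?_).trans (le_abs_self _))
    gcongr
    exact hK ⟨t, rfl⟩

lemma lintegral_norm_sq_eq (hH : (hessian f xstar).IsHermitian) (hβ0 : 0 ≤ β) (hβ1 : β < 1)
    (hμ : 0 < μ) (hindep : iIndepFun u ℙr)
    (hlaw : ∀ t, HasLaw (u t) (stdGaussian (Vec d)) ℙr) (x0 : Vec d) (t : ℕ) :
    ∫⁻ ω, ENNReal.ofReal (‖frozenZOAdam (quadModel f xstar) μ β P u η x0 t ω - xstar‖ ^ 2) ∂ℙr =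
      ENNReal.ofReal (∫ ω, ‖(zoState (toCLM (hessian f xstar)) (toCLM P⁻¹) β η (x0 - xstar)
        (fun s => u s ω) t).1‖ ^ 2 ∂ℙr) := by
  simp only [frozenZOAdam_sub f xstar hH hμ]
  rw [ofReal_integral_eq_lintegral_ofReal
    (memLp_zoState hβ0 hβ1 hindep hlaw t).1.integrable_norm_pow'
    (ae_of_all _ fun ω => by positivity)]

section Commuting

variable {e : OrthonormalBasis (Fin d) ℝ (Vec d)}

/-- In an orthonormal basis of modes, the noise intensity is a combination of the second moments
of the modes, so that these form a closed system. -/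
lemma isMomentSeq_orthonormal (hH : (hessian f xstar).IsHermitian) (hP : P.PosDef)
    (hHb : ∀ i, Matrix.toEuclideanLin (hessian f xstar) (e i) =
      lam i • Matrix.toEuclideanLin P (e i))
    (hβ0 : 0 ≤ β) (hβ1 : β < 1) (hindep : iIndepFun u ℙr)
    (hlaw : ∀ t, HasLaw (u t) (stdGaussian (Vec d)) ℙr) (hη : 0 < η) (w0 : Vec d)
    {X : ℕ → Ω → Vec d × Vec d} (hX : X = fun t ω =>
      zoState (toCLM (hessian f xstar)) (toCLM P⁻¹) β η w0 (fun s => u s ω) t) :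
    (∀ i, IsMomentSeq η β (lam i)
      (fun t => ∫ ω, inner ℝ (Matrix.toEuclideanLin P (e i)) (X t ω).1 ^ 2 ∂ℙr)
      (fun t => ∫ ω, inner ℝ (Matrix.toEuclideanLin P (e i)) (X t ω).1 *
        inner ℝ (e i) (X t ω).2 ∂ℙr)
      (fun t => ∫ ω, inner ℝ (e i) (X t ω).2 ^ 2 ∂ℙr)
      (fun t => ∫ ω, ‖toCLM (hessian f xstar) (X t ω).1‖ ^ 2 ∂ℙr)) ∧
    ∀ t, ∫ ω, ‖toCLM (hessian f xstar) (X t ω).1‖ ^ 2 ∂ℙr =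
      ∑ i, lam i ^ 2 * ∫ ω, inner ℝ (Matrix.toEuclideanLin P (e i)) (X t ω).1 ^ 2 ∂ℙr := by
  constructor
  · intro i
    have h := isMomentSeq_meanSquare (w0 := w0) hη hβ0 hβ1 hindep hlaw
      (toCLM_symm hH) (hHb i) (inner_toCLM_inv hP (e i)) hX
    simpa only [e.norm_eq_one, one_pow, one_mul] using h
  · intro t
    have hL : MemLp (fun ω => (X t ω).1) 2 ℙr := by
      rw [hX]; exact (memLp_zoState hβ0 hβ1 hindep hlaw t).1
    have ha (i : Fin d) :
        MemLp (fun ω => inner ℝ (Matrix.toEuclideanLin P (e i)) (X t ω).1) 2 ℙr :=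
      (innerSL ℝ (Matrix.toEuclideanLin P (e i))).comp_memLp' hL
    simp only [← integral_const_mul]
    rw [← integral_finsetSum _ fun i _ => (ha i).integrable_sq.const_mul _]
    congr 1
    ext ω
    rw [← e.sum_sq_norm_inner_right]
    refine Finset.sum_congr rfl fun i _ => ?_
    rw [inner_apply_eq (toCLM_symm hH) (hHb i), Real.norm_eq_abs, sq_abs, mul_pow]

lemma stableInMeanSquare_of_sum_gain_lt_one (hH : (hessian f xstar).IsHermitian) (hP : P.PosDef)
    (hHb : ∀ i, Matrix.toEuclideanLin (hessian f xstar) (e i) =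
      lam i • Matrix.toEuclideanLin P (e i)) (hlam : ∀ i, 0 ≤ lam i)
    (hβ0 : 0 ≤ β) (hβ1 : β < 1) (hμ : 0 < μ) (hindep : iIndepFun u ℙr)
    (hlaw : ∀ t, HasLaw (u t) (stdGaussian (Vec d)) ℙr) (hη : 0 < η)
    (hlt : ∀ i, η * lam i < 1 + β) (hF : ∑ i, gain η β (lam i) < 1) :
    StableInMeanSquare ℙr xstar (frozenZOAdam (quadModel f xstar) μ β P u η) := by
  intro x0
  obtain ⟨hmom, hS⟩ := isMomentSeq_orthonormal hH hP hHb hβ0 hβ1 hindep hlaw hη (x0 - xstar) rfl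
  have hbd := bddAbove_of_sum_gain_lt_one hmom hS hη hβ0 hβ1 hlam hlt hF
  choose B hB using hbd
  obtain ⟨K, hK0, hK⟩ := exists_norm_sq_le hP (span_range_orthonormalBasis e)
  refine lt_of_le_of_lt (iSup_le fun t => ?_) (ENNReal.ofReal_lt_top (r := K * ∑ i, B i))
  rw [lintegral_norm_sq_eq hH hβ0 hβ1 hμ hindep hlaw]
  apply ENNReal.ofReal_le_ofReal
  have hL := (memLp_zoState (A := toCLM (hessian f xstar)) (B := toCLM P⁻¹) (η := η)
    (w0 := x0 - xstar) hβ0 hβ1 hindep hlaw t).1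
  have ha (i : Fin d) : MemLp (fun ω => inner ℝ (Matrix.toEuclideanLin P (e i))
      (zoState (toCLM (hessian f xstar)) (toCLM P⁻¹) β η (x0 - xstar)
        (fun s => u s ω) t).1) 2 ℙr :=
    (innerSL ℝ (Matrix.toEuclideanLin P (e i))).comp_memLp' hL
  refine (integral_mono hL.integrable_norm_pow'
    ((integrable_finsetSum _ fun i _ => (ha i).integrable_sq).const_mul K) fun ω => hK _).trans ?_
  rw [integral_const_mul, integral_finsetSum _ fun i _ => (ha i).integrable_sq]
  gcongr with i
  exact hB i ⟨t, rfl⟩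

lemma not_stableInMeanSquare (hH : (hessian f xstar).IsHermitian) (hP : P.PosDef)
    (hHb : ∀ i, Matrix.toEuclideanLin (hessian f xstar) (e i) =
      lam i • Matrix.toEuclideanLin P (e i)) (hlam : ∀ i, 0 ≤ lam i) {i0 : Fin d}
    (hmax : ∀ i, lam i ≤ lam i0) (hi0 : 0 < lam i0)
    (hβ0 : 0 ≤ β) (hβ1 : β < 1) (hμ : 0 < μ) (hindep : iIndepFun u ℙr)
    (hlaw : ∀ t, HasLaw (u t) (stdGaussian (Vec d)) ℙr) (hη : 0 < η)
    (hF : η * lam i0 < 1 + β → 1 < ∑ i, gain η β (lam i)) :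
    ¬ StableInMeanSquare ℙr xstar (frozenZOAdam (quadModel f xstar) μ β P u η) := by
  intro hst
  have hsup := hst (xstar + e i0)
  obtain ⟨hmom, hS⟩ := isMomentSeq_orthonormal hH hP hHb hβ0 hβ1 hindep hlaw hη
    (xstar + e i0 - xstar) rfl
  have hY0 : 0 < ∫ ω, inner ℝ (Matrix.toEuclideanLin P (e i0))
      (zoState (toCLM (hessian f xstar)) (toCLM P⁻¹) β η (xstar + e i0 - xstar)
        (fun s => u s ω) 0).1 ^ 2 ∂ℙr := by
    have h := inner_toEuclideanLin_pos hP (e.orthonormal.ne_zero i0)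
    rw [real_inner_comm] at h
    simp only [zoState, add_sub_cancel_left, integral_const, probReal_univ, one_smul]
    positivity
  -- Unboundedness is proved for `E‖H w‖²` and then passes to `E‖w‖²` through the operator norm of
  -- `H`.
  have hunb : ¬ BddAbove (Set.range fun t => ∫ ω, ‖toCLM (hessian f xstar)
      (zoState (toCLM (hessian f xstar)) (toCLM P⁻¹) β η (xstar + e i0 - xstar)
        (fun s => u s ω) t).1‖ ^ 2 ∂ℙr) := by
    rcases lt_or_ge (η * lam i0) (1 + β) with hlt | hge
    · exact not_bddAbove_of_one_lt_sum_gain hmom hS hη hβ0 hβ1 hlam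
        (fun i => (mul_le_mul_of_nonneg_left (hmax i) hη.le).trans_lt hlt) (hF hlt) hi0 hY0
    · exact not_bddAbove_of_le_mul hmom hS hη hβ0 hβ1 hi0 hge hY0
  apply hunb
  refine ⟨‖toCLM (hessian f xstar)‖ ^ 2 * (⨆ t : ℕ, ∫⁻ ω, ENNReal.ofReal
    (‖frozenZOAdam (quadModel f xstar) μ β P u η (xstar + e i0) t ω - xstar‖ ^ 2) ∂ℙr).toReal, ?_⟩
  rintro _ ⟨t, rfl⟩
  have hL := (memLp_zoState (A := toCLM (hessian f xstar)) (B := toCLM P⁻¹) (η := η)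
    (w0 := xstar + e i0 - xstar) hβ0 hβ1 hindep hlaw t).1
  have hAL : MemLp (fun ω => toCLM (hessian f xstar) (zoState (toCLM (hessian f xstar))
      (toCLM P⁻¹) β η (xstar + e i0 - xstar) (fun s => u s ω) t).1) 2 ℙr :=
    (toCLM (hessian f xstar)).comp_memLp' hL
  refine (integral_mono hAL.integrable_norm_pow' (hL.integrable_norm_pow'.const_mul _)
    fun ω => ?_).trans ((integral_const_mul (‖toCLM (hessian f xstar)‖ ^ 2) _).le.trans ?_)
  · rw [← mul_pow]
    exact pow_le_pow_left₀ (norm_nonneg _) ((toCLM (hessian f xstar)).le_opNorm _) 2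
  · gcongr
    refine (ENNReal.ofReal_le_iff_le_toReal hsup.ne).1 ?_
    rw [← lintegral_norm_sq_eq hH hβ0 hβ1 hμ hindep hlaw]
    exact le_iSup (fun t => ∫⁻ ω, ENNReal.ofReal
      (‖frozenZOAdam (quadModel f xstar) μ β P u η (xstar + e i0) t ω - xstar‖ ^ 2) ∂ℙr) t

end Commuting

end ZOAdam
end

/-! ### Assembly of the two thresholds. -/

theorem mainTheorem3 {d : ℕ} (f : ZOAdam.Vec d → ℝ) (xstar : ZOAdam.Vec d)
    (hmin : IsLocalMin f xstar) (hdiff : ZOAdam.TwiceDifferentiableNear f xstar)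
    (H : Matrix (Fin d) (Fin d) ℝ) (hH : H = ZOAdam.hessian f xstar)
    (hpsd : H.PosSemidef) (hne : H ≠ 0)
    (P : Matrix (Fin d) (Fin d) ℝ) (hP : P.PosDef)
    (β : ℝ) (hβ0 : 0 ≤ β) (hβ1 : β < 1) (μ : ℝ) (hμ : 0 < μ)
    {Ω : Type*} [MeasurableSpace Ω] (ℙr : Measure Ω) [IsProbabilityMeasure ℙr]
    (u : ℕ → Ω → ZOAdam.Vec d) (hindep : iIndepFun u ℙr)
    (hlaw : ∀ t, HasLaw (u t) (stdGaussian (ZOAdam.Vec d)) ℙr) :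
    -- the eigenvalues of `P⁻¹ H` are all real and nonnegative
    ((ZOAdam.eigs (P⁻¹ * H)).card = d ∧ ∀ l ∈ ZOAdam.eigs (P⁻¹ * H), 0 ≤ l) ∧
    -- the critical step size in the mean
    ZOAdam.IsCriticalStepSizeMean ℙr xstar
      (ZOAdam.frozenZOAdam (ZOAdam.quadModel f xstar) μ β P u)
      (2 * (1 + β) / ((1 - β) * ZOAdam.lambdaMax (P⁻¹ * H))) ∧
    -- the critical step size in the mean-square
    (P * H = H * P →
      ∃ ηms : ℝ,
        ZOAdam.IsCriticalStepSizeMeanSquare ℙr xstar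
          (ZOAdam.frozenZOAdam (ZOAdam.quadModel f xstar) μ β P u) ηms ∧
        (∀ η : ℝ,
          (0 < η ∧ η * ZOAdam.lambdaMax (P⁻¹ * H) < 1 + β ∧
            ((ZOAdam.eigs (P⁻¹ * H)).map
              fun l => η * l / (2 * (1 - η * l / (1 + β)))).sum = 1) ↔ η = ηms) ∧
        2 / ((P⁻¹ * H).trace + 2 * ZOAdam.lambdaMax (P⁻¹ * H) / (1 + β)) ≤ ηms ∧
        ηms ≤ 2 / (P⁻¹ * H).trace) := by
  subst hH
  have hherm := hpsd.1
  have hβ : 0 < 1 - β := by linarith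
  obtain ⟨lam, b, hHb, hb, hlam, heigs⟩ := ZOAdam.exists_generalized_eigenvectors hpsd hP
  obtain ⟨i0, hmax, hi0⟩ := ZOAdam.exists_max_pos hne hHb hb hlam
  have hlmax := ZOAdam.lambdaMax_eq heigs hmax
  have heig0 : ∀ l ∈ ZOAdam.eigs (P⁻¹ * ZOAdam.hessian f xstar), 0 ≤ l := by
    intro l hl
    rw [heigs, Multiset.mem_map] at hl
    obtain ⟨i, -, rfl⟩ := hl
    exact hlam i
  refine ⟨⟨by simp [heigs], heig0⟩, ?_, fun hcomm => ?_⟩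
  · rw [hlmax]
    refine ZOAdam.isLUB_of_threshold (by positivity) (fun η hη hlt => ?_) fun η hgt => ?_
    · rw [lt_div_iff₀ (by positivity)] at hlt
      refine ZOAdam.stableInMean_of_lt hherm hP hHb hb hlam hβ0 hβ1 hμ hindep hlaw hη fun i => ?_
      have h1 : η * lam i * (1 - β) ≤ η * lam i0 * (1 - β) := by
        gcongr
        exact hmax i
      linarith
    · have hη : 0 < η := lt_trans (by positivity) hgt
      rw [div_lt_iff₀ (by positivity)] at hgt
      exact ZOAdam.not_stableInMean_of_lt hherm hP (hHb i0)
        (ZOAdam.ne_zero_of_span_eq_top hb i0) hi0 hβ0 hβ1 hμ hindep hlaw hη (by linarith)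
  -- The general eigenvectors need not be orthonormal and are replaced. Nonnegativity of the new
  -- eigenvalues comes from `heig0`, which refers only to the eigenvalue multiset.
  · clear hHb hb hlam heigs hmax hi0 hlmax lam b i0
    obtain ⟨lam, e, hHe, heigs, htr⟩ := ZOAdam.exists_orthonormal_eigenvectors hherm hP hcomm
    have hlam (i : Fin d) : 0 ≤ lam i := heig0 _ (by simp [heigs])
    obtain ⟨i0, hmax, hi0⟩ :=
      ZOAdam.exists_max_pos hne hHe (ZOAdam.span_range_orthonormalBasis e) hlam
    have hsum (η : ℝ) : ((ZOAdam.eigs (P⁻¹ * ZOAdam.hessian f xstar)).map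
        fun l => η * l / (2 * (1 - η * l / (1 + β)))).sum = ∑ i, ZOAdam.gain η β (lam i) := by
      rw [heigs, Multiset.map_map]
      rfl
    obtain ⟨ηc, hc0, hclt, hc1⟩ := ZOAdam.exists_sum_gain_eq_one hβ0 hlam hmax hi0
    rw [ZOAdam.lambdaMax_eq heigs hmax, htr]
    simp only [hsum]
    refine ⟨ηc, ZOAdam.isLUB_of_threshold hc0 (fun η hη hlt => ?_) fun η hgt => ?_, fun η =>
      ⟨?_, ?_⟩, ZOAdam.critical_bounds hβ0 hlam hmax hi0 hc0 hclt hc1⟩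
    · refine ZOAdam.stableInMeanSquare_of_sum_gain_lt_one hherm hP hHe hlam hβ0 hβ1 hμ hindep
        hlaw hη (fun i => (mul_le_mul hlt.le (hmax i) (hlam i) hc0.le).trans_lt hclt) ?_
      rw [← hc1]
      exact ZOAdam.sum_gain_lt hβ0 hlam hmax hi0 hη.le hlt hclt
    · refine ZOAdam.not_stableInMeanSquare hherm hP hHe hlam hmax hi0 hβ0 hβ1 hμ hindep hlaw
        (hc0.trans hgt) fun h => ?_
      rw [← hc1]
      exact ZOAdam.sum_gain_lt hβ0 hlam hmax hi0 hc0.le hgt h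
    · rintro ⟨hη, hlt, h1⟩
      rcases lt_trichotomy η ηc with h | h | h
      · have := ZOAdam.sum_gain_lt hβ0 hlam hmax hi0 hη.le h hclt
        linarith
      · exact h
      · have := ZOAdam.sum_gain_lt hβ0 hlam hmax hi0 hc0.le h hlt
        linarith
    · rintro rfl
      exact ⟨hc0, hclt, hc1⟩
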